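/- Let $\mathbb F$ be a field and let $p\ge 0$ be real. Tensors are trilinear maps $\mathbb F^{n_1}\times\mathbb F^{n_2}\times\mathbb F^{n_3}\to\mathbb F$; $\le$ denotes restriction ($S\le T$ iff $S=T\circ(A,B,C)$ for linear maps $A,B,C$), $\otimes$ and $\oplus$ are Kronecker product and direct sum, $\langle n\rangle=\sum_{i=1}^n x_iy_iz_i$ and $\langle a,b,c\rangle=\sum_{i\le a,\,j\le b,\,k\le c}x_{ij}y_{jk}z_{ki}$. The rank $R(T)$ is the least $n$ with $T\le\langle n\rangle$, and $\widetilde R(T)=\lim_{n\to\infty}R(T^{\otimes n})^{1/n}$. Logarithms without a base are to base $2$. Let $F$ be an upper support functional, that is, for some probability vector $\theta=(\theta_1,\theta_2,\theta_3)$, $$F(T)=\min_{S\cong T}\ \max_{P}\ 2^{\theta_1H(P_1)+\theta_2H(P_2)+\theta_3H(P_3)},$$ where $S$ ranges over the tensors obtained from $T$ by invertible linear maps on the three factors, $P$ over the probability distributions on the support of $S$, $P_i$ is the $i$-th marginal of $P$ and $H$ is the base-2 Shannon entropy (and $F(0)=0$). More generally, let $F$ be any map from tensors to $\mathbb R_{\ge0}$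 that is $\le$-monotone, submultiplicative under $\otimes$, multiplicative under $\otimes$ on pairs of matrix multiplication tensors, additive under $\oplus$, at most $\widetilde R$, and normalised by $F(\langle n\rangle)=n$ for all $n$. Put $F(\langle 2,2,2^p\rangle)=2^{\log_aF(\langle a,a,a^p\rangle)}$ if $a^p$ is an integer for some integer $a\ge2$ (the value does not depend on the choice of $a$), and otherwise let $F(\langle2,2,2^p\rangle)$ be the infimum of $F(\langle2,2,2^P\rangle)$ over all $P\ge p$ such that $a^P$ is an integer for some integer $a\ge 2$. A $T$-method for a tensor $T$ consists of a real number $r\ge\widetilde R(T)$ and a nonempty collection of valid inequalities $\langle n,n,m\rangle^{\oplus s}\le T^{\otimes k}$ with integers $n\ge2$, $s\ge1$, $m\ge n^p$, $k\ge0$. It yields $\hat\omega(p)=\inf\{k\log_nr-\log_ns\}$, the infimum over all inequalities of the collection. It is $\kappa$-catalytic ($\kappa\in\mathbb R$) if the values of $n$ in the collection are unbounded, the infimum $\hat\omega(p)$ is not attained by any single inequality, and there is a constant $C>0$ such that $s\ge Cn^\kappa$ in every inequality of the collection. **Theorem.** For every $T$-method, $F(T)>1$, the infimum $\hat\omega(p)$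 is finite, and $$\hat\omega(p)\ \ge\ \frac{\log F(\langle2,2,2^p\rangle)\,\log\widetilde R(T)}{\log F(T)}.$$ If the method is $\kappa$-catalytic, then moreover $$\hat\omega(p)\ \ge\ \frac{\log F(\langle2,2,2^p\rangle)\,\log\widetilde R(T)}{\log F(T)}+\kappa\left(\frac{\log\widetilde R(T)}{\log F(T)}-1\right).$$ -/

import Mathlib

open Filter Topology

/-- A tensor over `K`: the coefficient array (indexed by finite types) of a trilinear map
`K^I × K^J × K^L → K`. -/
structure Tensor3 (K : Type*) where
  I : Type
  J : Type
  L : Type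
  [fintypeI : Fintype I]
  [fintypeJ : Fintype J]
  [fintypeL : Fintype L]
  coeff : I → J → L → K

namespace Tensor3

attribute [instance] fintypeI fintypeJ fintypeL

/-- The value at `(x, y, z)` of the trilinear map with coefficient array `t`. -/
def trilin {K I J L : Type*} [Field K] [Fintype I] [Fintype J] [Fintype L]
    (t : I → J → L → K) (x : I → K) (y : J → K) (z : L → K) : K :=
  ∑ i, ∑ j, ∑ l, t i j l * x i * y j * z l

/-- `Restricts S T` is `S ≤ T`, i.e. `S = T ∘ (A, B, C)` for some linear maps `A`, `B`, `C`. -/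
def Restricts {K : Type*} [Field K] (S T : Tensor3 K) : Prop :=
  ∃ (A : (S.I → K) →ₗ[K] (T.I → K)) (B : (S.J → K) →ₗ[K] (T.J → K))
    (C : (S.L → K) →ₗ[K] (T.L → K)),
    ∀ x y z, trilin S.coeff x y z = trilin T.coeff (A x) (B y) (C z)

/-- The diagonal tensor `⟨n⟩`, i.e. `∑ i, x_i y_i z_i`. -/
def unit (K : Type*) [Field K] (n : ℕ) : Tensor3 K where
  I := Fin n
  J := Fin n
  L := Fin n
  coeff i j l := if i = j ∧ j = l then 1 else 0

/-- The matrix multiplication tensor `⟨a, b, c⟩`, i.e. `∑ i j k, x_{ij} y_{jk} z_{ki}`. -/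
def matMul (K : Type*) [Field K] (a b c : ℕ) : Tensor3 K where
  I := Fin a × Fin b
  J := Fin b × Fin c
  L := Fin c × Fin a
  coeff x y z := if x.2 = y.1 ∧ y.2 = z.1 ∧ z.2 = x.1 then 1 else 0

/-- The Kronecker product `S ⊗ T`. -/
def kron {K : Type*} [Field K] (S T : Tensor3 K) : Tensor3 K where
  I := S.I × T.I
  J := S.J × T.J
  L := S.L × T.L
  coeff x y z := S.coeff x.1 y.1 z.1 * T.coeff x.2 y.2 z.2

/-- The Kronecker power `T^{⊗ k}`. -/
def kronPow {K : Type*} [Field K] (T : Tensor3 K) : ℕ → Tensor3 K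
  | 0 => unit K 1
  | k + 1 => kron (kronPow T k) T

/-- The direct sum `S ⊕ T`. -/
def dsum {K : Type*} [Field K] (S T : Tensor3 K) : Tensor3 K where
  I := S.I ⊕ T.I
  J := S.J ⊕ T.J
  L := S.L ⊕ T.L
  coeff x y z :=
    match x, y, z with
    | .inl i, .inl j, .inl l => S.coeff i j l
    | .inr i, .inr j, .inr l => T.coeff i j l
    | _, _, _ => 0

/-- The `s`-fold direct sum `T^{⊕ s}`; the empty direct sum is the tensor of format `0 × 0 × 0`. -/
def dsumPow {K : Type*} [Field K] (T : Tensor3 K) : ℕ → Tensor3 K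
  | 0 => unit K 0
  | s + 1 => dsum (dsumPow T s) T

/-- The tensor rank: the smallest `n` such that `T ≤ ⟨n⟩`. -/
noncomputable def rank {K : Type*} [Field K] (T : Tensor3 K) : ℕ :=
  sInf {n | Restricts T (unit K n)}

/-- The asymptotic rank, the limit of `rank (T^{⊗ n})^{1/n}`
(see `tendsto_asymptoticRank` for its existence). -/
noncomputable def asymptoticRank {K : Type*} [Field K] (T : Tensor3 K) : ℝ :=
  limUnder atTop (fun n : ℕ => (rank (kronPow T n) : ℝ) ^ (1 / (n : ℝ)))

/-! ### The limit defining the asymptotic rank exists -/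

theorem sum_comm_three {K I J L I' J' L' : Type*} [Field K] [Fintype I] [Fintype J] [Fintype L]
    [Fintype I'] [Fintype J'] [Fintype L'] (f : I → J → L → I' → J' → L' → K) :
    ∑ i, ∑ j, ∑ l, ∑ i', ∑ j', ∑ l', f i j l i' j' l' =
      ∑ i', ∑ j', ∑ l', ∑ i, ∑ j, ∑ l, f i j l i' j' l' := by
  have h := Finset.sum_comm (s := (Finset.univ : Finset (I × J × L)))
    (t := (Finset.univ : Finset (I' × J' × L')))
    (f := fun u v => f u.1 u.2.1 u.2.2 v.1 v.2.1 v.2.2)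
  simpa only [Fintype.sum_prod_type] using h

theorem trilin_single {K I J L : Type*} [Field K] [Fintype I] [Fintype J] [Fintype L]
    [DecidableEq I] [DecidableEq J] [DecidableEq L]
    (t : I → J → L → K) (i : I) (j : J) (l : L) :
    trilin t (Pi.single i 1) (Pi.single j 1) (Pi.single l 1) = t i j l := by
  simp [trilin, Pi.single_apply]

/-- Restriction in coordinates. -/
theorem restricts_iff {K : Type*} [Field K] {S T : Tensor3 K} :
    Restricts S T ↔ ∃ (a : T.I → S.I → K) (b : T.J → S.J → K) (c : T.L → S.L → K),
      ∀ i j l, S.coeff i j l =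
        ∑ i', ∑ j', ∑ l', T.coeff i' j' l' * a i' i * b j' j * c l' l := by
  classical
  constructor
  · rintro ⟨A, B, C, h⟩
    refine ⟨fun i' i => A (Pi.single i 1) i', fun j' j => B (Pi.single j 1) j',
      fun l' l => C (Pi.single l 1) l', fun i j l => ?_⟩
    rw [← trilin_single S.coeff i j l, h]
    rfl
  · rintro ⟨a, b, c, h⟩
    refine ⟨Matrix.mulVecLin (Matrix.of a), Matrix.mulVecLin (Matrix.of b),
      Matrix.mulVecLin (Matrix.of c), fun x y z => ?_⟩
    simp only [trilin, Matrix.mulVecLin_apply, Matrix.mulVec, dotProduct, Matrix.of_apply, h,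
      Finset.sum_mul]
    rw [sum_comm_three]
    refine Finset.sum_congr rfl fun i' _ => Finset.sum_congr rfl fun j' _ =>
      Finset.sum_congr rfl fun l' _ => ?_
    have e : ∀ (u : K) (f : S.I → K) (g : S.J → K) (k : S.L → K),
        u * (∑ i, f i) * (∑ j, g j) * (∑ l, k l) = ∑ i, ∑ j, ∑ l, u * f i * g j * k l := by
      intro u f g k
      simp_rw [← Finset.mul_sum, ← Finset.sum_mul, ← Finset.mul_sum, ← Finset.sum_mul,
        ← Finset.mul_sum]
    rw [e]
    refine Finset.sum_congr rfl fun i _ => Finset.sum_congr rfl fun j _ =>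
      Finset.sum_congr rfl fun l _ => ?_
    ring

theorem Restricts.refl {K : Type*} [Field K] (T : Tensor3 K) : Restricts T T :=
  ⟨LinearMap.id, LinearMap.id, LinearMap.id, fun _ _ _ => rfl⟩

theorem Restricts.trans {K : Type*} [Field K] {R S T : Tensor3 K} (h₁ : Restricts R S)
    (h₂ : Restricts S T) : Restricts R T := by
  obtain ⟨A, B, C, h⟩ := h₁
  obtain ⟨A', B', C', h'⟩ := h₂
  exact ⟨A' ∘ₗ A, B' ∘ₗ B, C' ∘ₗ C, fun x y z => by rw [h, h']; rfl⟩

/-- Relabelling the index types. -/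
theorem restricts_of_maps {K : Type*} [Field K] {S T : Tensor3 K} (f : S.I → T.I) (g : S.J → T.J)
    (h : S.L → T.L) (H : ∀ i j l, S.coeff i j l = T.coeff (f i) (g j) (h l)) :
    Restricts S T := by
  classical
  refine restricts_iff.2 ⟨fun i' i => if i' = f i then 1 else 0,
    fun j' j => if j' = g j then 1 else 0, fun l' l => if l' = h l then 1 else 0, ?_⟩
  intro i j l
  simp [H]

theorem Restricts.kron {K : Type*} [Field K] {S S' T T' : Tensor3 K} (h : Restricts S S')
    (h' : Restricts T T') : Restricts (S.kron T) (S'.kron T') := by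
  obtain ⟨a, b, c, H⟩ := restricts_iff.1 h
  obtain ⟨a', b', c', H'⟩ := restricts_iff.1 h'
  refine restricts_iff.2 ⟨fun x y => a x.1 y.1 * a' x.2 y.2, fun x y => b x.1 y.1 * b' x.2 y.2,
    fun x y => c x.1 y.1 * c' x.2 y.2, fun x y z => ?_⟩
  have e : ∀ {α β : Type} [Fintype α] [Fintype β] (f : α → K) (g : β → K),
      ∑ x : α × β, f x.1 * g x.2 = (∑ a, f a) * ∑ b, g b := by
    intro α β _ _ f g
    rw [Fintype.sum_mul_sum, Fintype.sum_prod_type]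
  simp only [Tensor3.kron, H, H']
  rw [← e]
  refine Finset.sum_congr rfl fun i' _ => ?_
  rw [← e]
  refine Finset.sum_congr rfl fun j' _ => ?_
  rw [← e]
  refine Finset.sum_congr rfl fun l' _ => ?_
  ring

theorem restricts_unit {K : Type*} [Field K] (T : Tensor3 K) :
    ∃ n, Restricts T (unit K n) := by
  classical
  let e := Fintype.equivFin (T.I × T.J × T.L)
  refine ⟨Fintype.card (T.I × T.J × T.L), restricts_iff.2
    ⟨fun u i => if (e.symm u).1 = i then T.coeff i (e.symm u).2.1 (e.symm u).2.2 else 0,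
      fun u j => if (e.symm u).2.1 = j then 1 else 0,
      fun u l => if (e.symm u).2.2 = l then 1 else 0, fun i j l => ?_⟩⟩
  have e1 : ∀ u : Fin (Fintype.card (T.I × T.J × T.L)),
      (∑ j' : Fin (Fintype.card (T.I × T.J × T.L)), ∑ l' : Fin (Fintype.card (T.I × T.J × T.L)),
        (if u = j' ∧ j' = l' then (1 : K) else 0) *
        (if (e.symm u).1 = i then T.coeff i (e.symm u).2.1 (e.symm u).2.2 else 0) *
        (if (e.symm j').2.1 = j then 1 else 0) * (if (e.symm l').2.2 = l then 1 else 0)) =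
      if e.symm u = (i, j, l) then T.coeff i j l else 0 := by
    intro u
    rw [Finset.sum_eq_single u, Finset.sum_eq_single u]
    · obtain ⟨⟨a, b, c⟩, rfl⟩ := e.surjective u
      simp only [Equiv.symm_apply_apply, Prod.mk.injEq]
      split_ifs <;> simp_all
    · intro l' _ hl
      simp [hl.symm]
    · intro h
      exact absurd (Finset.mem_univ u) h
    · intro j' _ hj
      simp [hj.symm]
    · intro h
      exact absurd (Finset.mem_univ u) h
  have e2 := Finset.sum_congr rfl
    (fun (u : Fin (Fintype.card (T.I × T.J × T.L))) (_ : u ∈ Finset.univ) => e1 u)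
  rw [e.symm.sum_comp (fun v => if v = (i, j, l) then T.coeff i j l else 0),
    Finset.sum_ite_eq' Finset.univ (i, j, l), if_pos (Finset.mem_univ _)] at e2
  exact e2.symm

theorem restricts_rank {K : Type*} [Field K] (T : Tensor3 K) : Restricts T (unit K T.rank) :=
  Nat.sInf_mem (restricts_unit T)

theorem rank_kron_le {K : Type*} [Field K] (S T : Tensor3 K) :
    (S.kron T).rank ≤ S.rank * T.rank := by
  refine Nat.sInf_le (Restricts.trans (S.restricts_rank.kron T.restricts_rank) ?_)
  let e : Fin S.rank × Fin T.rank ≃ Fin (S.rank * T.rank) := finProdFinEquiv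
  refine restricts_of_maps e e e fun (x : Fin S.rank × Fin T.rank)
    (y : Fin S.rank × Fin T.rank) (z : Fin S.rank × Fin T.rank) => ?_
  have h1 : ∀ x y, e x = e y ↔ x.1 = y.1 ∧ x.2 = y.2 := fun x y => by
    rw [e.apply_eq_iff_eq, Prod.ext_iff]
  simp only [Tensor3.kron, unit, h1]
  split_ifs <;> simp_all

theorem Restricts.rank_le {K : Type*} [Field K] {S T : Tensor3 K} (h : Restricts S T) :
    S.rank ≤ T.rank :=
  Nat.sInf_le (h.trans T.restricts_rank)

theorem restricts_kronPow_add {K : Type*} [Field K] (T : Tensor3 K) (m n : ℕ) :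
    Restricts (T.kronPow (m + n)) ((T.kronPow m).kron (T.kronPow n)) := by
  induction n with
  | zero =>
    refine restricts_of_maps (fun x => (x, (0 : Fin 1))) (fun x => (x, (0 : Fin 1)))
      (fun x => (x, (0 : Fin 1))) fun x y z => ?_
    simp [Tensor3.kron, kronPow, unit]
  | succ n ih =>
    refine (ih.kron (Restricts.refl T)).trans ?_
    exact restricts_of_maps (fun x => (x.1.1, x.1.2, x.2)) (fun x => (x.1.1, x.1.2, x.2))
      (fun x => (x.1.1, x.1.2, x.2)) fun x y z => mul_assoc _ _ _

theorem rank_kronPow_add_le {K : Type*} [Field K] (T : Tensor3 K) (m n : ℕ) :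
    (T.kronPow (m + n)).rank ≤ (T.kronPow m).rank * (T.kronPow n).rank :=
  (T.restricts_kronPow_add m n).rank_le.trans (rank_kron_le _ _)

theorem tendsto_asymptoticRank {K : Type*} [Field K] (T : Tensor3 K) :
    Tendsto (fun n : ℕ => (rank (kronPow T n) : ℝ) ^ (1 / (n : ℝ))) atTop
      (𝓝 T.asymptoticRank) := by
  refine tendsto_nhds_limUnder ?_
  by_cases h0 : ∃ n, (T.kronPow n).rank = 0
  · obtain ⟨n, hn⟩ := h0
    refine ⟨0, tendsto_const_nhds.congr' ?_⟩
    filter_upwards [eventually_ge_atTop (n + 1)] with m hm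
    obtain ⟨d, rfl⟩ := Nat.exists_eq_add_of_le (show n ≤ m by omega)
    have h := T.rank_kronPow_add_le n d
    rw [hn, zero_mul, Nat.le_zero] at h
    have hne : ((n + d : ℕ) : ℝ) ≠ 0 := by
      exact_mod_cast (show n + d ≠ 0 by omega)
    rw [h, Nat.cast_zero, Real.zero_rpow (one_div_ne_zero hne)]
  · push Not at h0
    have hpos : ∀ n, (1 : ℝ) ≤ (T.kronPow n).rank := fun n => by
      exact_mod_cast Nat.one_le_iff_ne_zero.2 (h0 n)
    have hsub : Subadditive (fun n => Real.log (T.kronPow n).rank) := fun m n => by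
      rw [← Real.log_mul (by linarith [hpos m]) (by linarith [hpos n])]
      exact Real.log_le_log (by linarith [hpos (m + n)])
        (by exact_mod_cast T.rank_kronPow_add_le m n)
    have hlim := hsub.tendsto_lim ⟨0, by
      rintro _ ⟨n, rfl⟩
      exact div_nonneg (Real.log_nonneg (hpos n)) n.cast_nonneg⟩
    refine ⟨_, ((Real.continuous_exp.tendsto _).comp hlim).congr fun n => ?_⟩
    rw [Function.comp_apply, Real.rpow_def_of_pos (by linarith [hpos n]), mul_one_div]

/-! ### Support functionals and the class of tensor parameters -/

/-- The Shannon entropy (base `2`) of `q`. -/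
noncomputable def entropy {α : Type*} [Fintype α] (q : α → ℝ) : ℝ :=
  ∑ a, Real.negMulLog (q a) / Real.log 2

/-- `max_P 2 ^ (∑ i, θ_i H(P_i))`, over the probability vectors `P` on the support of the array `t`,
where `P_i` are the marginals of `P`. For `t = 0` there is no such `P`, and the value is `0`. -/
noncomputable def supportValue {K I J L : Type*} [Field K] [Fintype I] [Fintype J] [Fintype L]
    (θ : Fin 3 → ℝ) (t : I → J → L → K) : ℝ :=
  sSup {v | ∃ P ∈ stdSimplex ℝ (I × J × L), (∀ i j l, t i j l = 0 → P (i, j, l) = 0) ∧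
    v = (2 : ℝ) ^ (θ 0 * entropy (fun i => ∑ j, ∑ l, P (i, j, l)) +
      θ 1 * entropy (fun j => ∑ i, ∑ l, P (i, j, l)) +
      θ 2 * entropy (fun l => ∑ i, ∑ j, P (i, j, l)))}

/-- The upper support functional `ζ^θ(T)`: the minimum of `supportValue θ S` over all `S` obtained
from `T` by invertible linear maps. -/
noncomputable def upperSupport {K : Type*} [Field K] (θ : Fin 3 → ℝ) (T : Tensor3 K) : ℝ :=
  sInf {v | ∃ (A : (T.I → K) ≃ₗ[K] (T.I → K)) (B : (T.J → K) ≃ₗ[K] (T.J → K))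
    (C : (T.L → K) ≃ₗ[K] (T.L → K)) (S : T.I → T.J → T.L → K),
    (∀ x y z, trilin S x y z = trilin T.coeff (A x) (B y) (C z)) ∧ v = supportValue θ S}

/-- The maps from tensors to nonnegative reals to which the barrier applies. -/
structure IsBarrierFunctional {K : Type*} [Field K] (F : Tensor3 K → ℝ) : Prop where
  nonneg : ∀ T, 0 ≤ F T
  mono : ∀ S T, Restricts S T → F S ≤ F T
  submul : ∀ S T, F (kron S T) ≤ F S * F T
  matMul_mul : ∀ a b c a' b' c' : ℕ,
    F (kron (matMul K a b c) (matMul K a' b' c')) = F (matMul K a b c) * F (matMul K a' b' c')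
  add : ∀ S T, F (dsum S T) = F S + F T
  le_asymptoticRank : ∀ T, F T ≤ asymptoticRank T
  normalized : ∀ n : ℕ, F (unit K n) = n

/-- The values `2 ^ (log_a F(⟨a, a, b⟩))` over the integers `a ≥ 2`, `b` with `b = a ^ P`.
It has at most one element for every `F` considered here. -/
def quasiValues {K : Type*} [Field K] (F : Tensor3 K → ℝ) (P : ℝ) : Set ℝ :=
  {v | ∃ a b : ℕ, 2 ≤ a ∧ (a : ℝ) ^ P = b ∧ v = (2 : ℝ) ^ Real.logb a (F (matMul K a a b))}

open Classical in
/-- The value of `F` on the quasitensor `⟨2, 2, 2^p⟩`: the common value of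
`2 ^ (log_a F(⟨a, a, a^p⟩))` if `a ^ p` is an integer for some integer `a ≥ 2`, and otherwise the
infimum of the values at those `P ≥ p` for which some `a ^ P` is an integer. -/
noncomputable def quasi {K : Type*} [Field K] (F : Tensor3 K → ℝ) (p : ℝ) : ℝ :=
  if (quasiValues F p).Nonempty then sInf (quasiValues F p)
  else sInf {v | ∃ P : ℝ, p ≤ P ∧ v ∈ quasiValues F P}

/-! ### `T`-methods -/

/-- The parameters of an inequality `⟨n, n, m⟩^{⊕ s} ≤ T^{⊗ k}`. -/
structure Params where
  n : ℕ
  m : ℕ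
  s : ℕ
  k : ℕ

/-- A `T`-method for `ω(p)`: an upper bound `r` on the asymptotic rank of `T` and a nonempty
collection of valid inequalities `⟨n, n, m⟩^{⊕ s} ≤ T^{⊗ k}` with `n ^ p ≤ m`. -/
structure TMethod {K : Type*} [Field K] (T : Tensor3 K) (p : ℝ) where
  r : ℝ
  asymptoticRank_le : asymptoticRank T ≤ r
  reductions : Set Params
  nonempty : reductions.Nonempty
  two_le : ∀ R ∈ reductions, 2 ≤ R.n
  one_le : ∀ R ∈ reductions, 1 ≤ R.s
  rpow_le : ∀ R ∈ reductions, (R.n : ℝ) ^ p ≤ R.m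
  restricts : ∀ R ∈ reductions,
    Restricts (dsumPow (matMul K R.n R.n R.m) R.s) (kronPow T R.k)

namespace TMethod

/-- The bound `k log_n r - log_n s` given by a single inequality. -/
noncomputable def bound {K : Type*} [Field K] {T : Tensor3 K} {p : ℝ} (M : TMethod T p)
    (R : Params) : ℝ :=
  R.k * Real.logb R.n M.r - Real.logb R.n R.s

/-- The upper bound `ω̂(p)` obtained by the method. -/
noncomputable def omegaHat {K : Type*} [Field K] {T : Tensor3 K} {p : ℝ} (M : TMethod T p) : ℝ :=
  sInf (M.bound '' M.reductions)

/-- The method is `κ`-catalytic: the values of `n` are unbounded, `ω̂(p)` is not attained on any one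
reduction, and `s ≥ C n ^ κ` in every reduction, for some constant `C > 0`. -/
def IsCatalytic {K : Type*} [Field K] {T : Tensor3 K} {p : ℝ} (M : TMethod T p) (κ : ℝ) : Prop :=
  (∀ N : ℕ, ∃ R ∈ M.reductions, N ≤ R.n) ∧
  M.omegaHat ∉ M.bound '' M.reductions ∧
  ∃ C : ℝ, 0 < C ∧ ∀ R ∈ M.reductions, C * (R.n : ℝ) ^ κ ≤ R.s

end TMethod

end Tensor3

/-!
The barrier itself is a computation with the functional `F`. An inequality
`⟨n, n, m⟩^{⊕ s} ≤ T^{⊗ k}` gives `s * F(⟨n, n, m⟩) ≤ F(T) ^ k`, and `F(⟨n, n, m⟩)` is at least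
`n ^ log F(⟨2, 2, 2^p⟩)`: compare large powers of `⟨a, a, a^p⟩` and `⟨n, n, m⟩` of almost the same
size (`IsBarrierFunctional.logb_matMul_le`). With `ρ = log R̃(T) / log F(T) ≥ 1` it follows that
`k log_n r - log_n s ≥ ρ log F(⟨2, 2, 2^p⟩) + (ρ - 1) log_n s`
(`IsBarrierFunctional.le_bound`), whose last term is nonnegative. If `ρ = 1`, the catalytic
term vanishes. If `ρ > 1`, then `log_n s ≥ κ + log_n C` shows that bounds below the catalytic value
by a fixed margin come from bounded `n`. These bounds form a finite set, because the estimate also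
limits `s` and `k` (`IsBarrierFunctional.finite_bounds`), so an infimum below the catalytic value
would be attained.

It remains to see that an upper support functional `ζ^θ` has the properties of
`IsBarrierFunctional`. By duality, the maximum of `2 ^ ∑ θᵢ H(Pᵢ)` over probability vectors on the
support of `S` is the least `M` for which there are subprobability vectors `p, q, r` on the three
index sets with `1 ≤ M * p_i ^ θ₀ * q_j ^ θ₁ * r_l ^ θ₂` on the support (`supportValue_le`,
`exists_weights`); optimal `p, q, r` are the marginals of a maximizer. So `ζ^θ(T)` is the infimum of
the `M` for which `T` has a `Certificate`: bases of the three spaces with such weights. The weights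
define flags, and elimination (`exists_adapted_basis`) produces bases adapted to these flags and to
another given structure without increasing the total weight:
* for a restriction, a basis of the source of each linear map, which gives monotonicity;
* for a direct sum, bases of one summand as a subspace and of the other as a quotient, which gives
  superadditivity by the weighted inequality of arithmetic and geometric means
  (`Certificate.add_le`);
* for a tensor whose support is an antichain, bases unitriangular in the standard basis, which do
  not change the coefficients on the support (`Certificate.exists_weights_of_antichain`). This
  applies to `⟨a, b, c⟩` and gives the value `(ab) ^ θ₀ * (bc) ^ θ₁ * (ca) ^ θ₂`.

Finally `ζ^θ(T)` is at most the weighted geometric mean of the three flattening ranks of `T`, and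
each of these is multiplicative and bounded by the rank, hence at most `R̃(T)`.
-/

namespace Tensor3

/-! ### Matrix multiplication tensors -/

theorem restricts_matMul_of_le {K : Type*} [Field K] {a b c a' b' c' : ℕ} (ha : a ≤ a')
    (hb : b ≤ b') (hc : c ≤ c') : Restricts (matMul K a b c) (matMul K a' b' c') := by
  refine restricts_of_maps (Prod.map (Fin.castLE ha) (Fin.castLE hb))
    (Prod.map (Fin.castLE hb) (Fin.castLE hc)) (Prod.map (Fin.castLE hc) (Fin.castLE ha))
    ?_
  rintro ⟨x1, x2⟩ ⟨y1, y2⟩ ⟨z1, z2⟩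
  simp [matMul]

theorem restricts_kron_matMul {K : Type*} [Field K] (a b c a' b' c' : ℕ) :
    Restricts (kron (matMul K a b c) (matMul K a' b' c'))
      (matMul K (a * a') (b * b') (c * c')) := by
  refine restricts_of_maps
    (fun x => (finProdFinEquiv (x.1.1, x.2.1), finProdFinEquiv (x.1.2, x.2.2)))
    (fun x => (finProdFinEquiv (x.1.1, x.2.1), finProdFinEquiv (x.1.2, x.2.2)))
    (fun x => (finProdFinEquiv (x.1.1, x.2.1), finProdFinEquiv (x.1.2, x.2.2))) ?_
  rintro ⟨⟨x1, x2⟩, x3, x4⟩ ⟨⟨y1, y2⟩, y3, y4⟩ ⟨⟨z1, z2⟩, z3, z4⟩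
  simp only [kron, matMul, finProdFinEquiv.apply_eq_iff_eq, Prod.mk.injEq]
  split_ifs <;> simp_all

theorem matMul_restricts_kron {K : Type*} [Field K] (a b c a' b' c' : ℕ) :
    Restricts (matMul K (a * a') (b * b') (c * c'))
      (kron (matMul K a b c) (matMul K a' b' c')) := by
  refine restricts_of_maps
    (fun x => (((finProdFinEquiv.symm x.1).1, (finProdFinEquiv.symm x.2).1),
      ((finProdFinEquiv.symm x.1).2, (finProdFinEquiv.symm x.2).2)))
    (fun x => (((finProdFinEquiv.symm x.1).1, (finProdFinEquiv.symm x.2).1),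
      ((finProdFinEquiv.symm x.1).2, (finProdFinEquiv.symm x.2).2)))
    (fun x => (((finProdFinEquiv.symm x.1).1, (finProdFinEquiv.symm x.2).1),
      ((finProdFinEquiv.symm x.1).2, (finProdFinEquiv.symm x.2).2))) ?_
  rintro ⟨x1, x2⟩ ⟨y1, y2⟩ ⟨z1, z2⟩
  have e : ∀ {m n : ℕ} (u v : Fin (m * n)), u = v ↔ (finProdFinEquiv.symm u).1 =
      (finProdFinEquiv.symm v).1 ∧ (finProdFinEquiv.symm u).2 = (finProdFinEquiv.symm v).2 :=
    fun u v => by rw [← Prod.ext_iff, finProdFinEquiv.symm.apply_eq_iff_eq]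
  simp only [kron, matMul, e]
  split_ifs <;> simp_all

theorem unit_restricts_matMul {K : Type*} [Field K] (n : ℕ) {m : ℕ} (hm : 1 ≤ m) :
    Restricts (unit K n) (matMul K n n m) := by
  refine restricts_of_maps (fun i => (i, i)) (fun i => (i, ⟨0, hm⟩)) (fun i => (⟨0, hm⟩, i))
    fun x y z => ?_
  simp only [unit, matMul, true_and]
  congr 1
  grind

theorem matMul_one_restricts_unit {K : Type*} [Field K] :
    Restricts (matMul K 1 1 1) (unit K 1) := by
  refine restricts_of_maps (fun x => x.1) (fun x => x.1) (fun x => x.1) ?_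
  rintro ⟨x1, x2⟩ ⟨y1, y2⟩ ⟨z1, z2⟩
  simp [unit, matMul, Fin.fin_one_eq_zero]

/-! ### The barrier -/

namespace IsBarrierFunctional

variable {K : Type*} [Field K] {F : Tensor3 K → ℝ}

theorem dsumPow (hF : IsBarrierFunctional F) (T : Tensor3 K) (s : ℕ) :
    F (T.dsumPow s) = s * F T := by
  induction s with
  | zero => simpa [Tensor3.dsumPow] using hF.normalized 0
  | succ s ih => rw [Tensor3.dsumPow, hF.add, ih]; push_cast; ring

theorem kronPow_le (hF : IsBarrierFunctional F) (T : Tensor3 K) (k : ℕ) :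
    F (T.kronPow k) ≤ F T ^ k := by
  induction k with
  | zero => simpa [Tensor3.kronPow] using (hF.normalized 1).le
  | succ k ih =>
    rw [Tensor3.kronPow, pow_succ]
    exact (hF.submul _ _).trans (mul_le_mul_of_nonneg_right ih (hF.nonneg T))

theorem matMul_mul_eq (hF : IsBarrierFunctional F) (a b c a' b' c' : ℕ) :
    F (matMul K (a * a') (b * b') (c * c')) = F (matMul K a b c) * F (matMul K a' b' c') := by
  rw [← hF.matMul_mul]
  exact le_antisymm (hF.mono _ _ (matMul_restricts_kron ..))
    (hF.mono _ _ (restricts_kron_matMul ..))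

theorem le_matMul (hF : IsBarrierFunctional F) (n : ℕ) {m : ℕ} (hm : 1 ≤ m) :
    (n : ℝ) ≤ F (matMul K n n m) := by
  rw [← hF.normalized n]
  exact hF.mono _ _ (unit_restricts_matMul n hm)

theorem matMul_pow (hF : IsBarrierFunctional F) (a b c i : ℕ) :
    F (matMul K (a ^ i) (b ^ i) (c ^ i)) = F (matMul K a b c) ^ i := by
  induction i with
  | zero =>
    refine le_antisymm ?_ (by simpa using hF.le_matMul (K := K) 1 le_rfl)
    simpa [hF.normalized] using hF.mono _ _ (matMul_one_restricts_unit (K := K))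
  | succ i ih => rw [pow_succ, pow_succ, pow_succ, hF.matMul_mul_eq, ih, pow_succ]

/-- The exponent `log_n F(⟨n, n, m⟩)` is monotone in `log_n m`: compare a power of `⟨a, a, a^p⟩`
with a power of `⟨n, n, m⟩` of almost the same size. -/
theorem logb_matMul_le (hF : IsBarrierFunctional F) {p : ℝ} (hp : 0 ≤ p) {a b n m : ℕ} (ha : 2 ≤ a)
    (hab : (a : ℝ) ^ p = b) (hn : 2 ≤ n) (hm : (n : ℝ) ^ p ≤ m) :
    Real.logb a (F (matMul K a a b)) ≤ Real.logb n (F (matMul K n n m)) := by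
  have ha' : (2 : ℝ) ≤ a := by exact_mod_cast ha
  have hn' : (2 : ℝ) ≤ n := by exact_mod_cast hn
  have hm1 : 1 ≤ m := by
    exact_mod_cast (Real.one_le_rpow (by linarith : (1 : ℝ) ≤ n) hp).trans hm
  have hb1 : 1 ≤ b := by
    exact_mod_cast (Real.one_le_rpow (by linarith : (1 : ℝ) ≤ a) hp).trans hab.le
  have hla : 0 < Real.log a := Real.log_pos (by linarith)
  have hln : 0 < Real.log n := Real.log_pos (by linarith)
  have hFa := hF.le_matMul (K := K) a hb1
  have hFn := hF.le_matMul (K := K) n hm1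
  set x := Real.log (F (matMul K a a b)) with hx
  set y := Real.log (F (matMul K n n m)) with hy
  have hx0 : 0 ≤ x := Real.log_nonneg (by linarith)
  have key : ∀ j : ℕ, j * (x * Real.log n) ≤ j * (y * Real.log a) + x * Real.log a := by
    intro j
    -- the largest `i` with `a ^ i ≤ n ^ j`
    set i := ⌊j * Real.log n / Real.log a⌋₊ with hi
    have hi1 : i * Real.log a ≤ j * Real.log n := by
      rw [← le_div_iff₀ hla]
      exact Nat.floor_le (by positivity)
    have hi2 : j * Real.log n ≤ (i + 1) * Real.log a := by
      rw [← div_le_iff₀ hla]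
      exact (Nat.lt_floor_add_one _).le
    have han : (a : ℝ) ^ i ≤ (n : ℝ) ^ j := by
      rw [← Real.log_le_log_iff (by positivity) (by positivity), Real.log_pow, Real.log_pow]
      exact hi1
    have hbm : (b : ℝ) ^ i ≤ (m : ℝ) ^ j := by
      calc (b : ℝ) ^ i = ((a : ℝ) ^ i) ^ p := by
            rw [← hab, Real.rpow_pow_comm (by positivity)]
        _ ≤ ((n : ℝ) ^ j) ^ p := Real.rpow_le_rpow (by positivity) han hp
        _ = ((n : ℝ) ^ p) ^ j := (Real.rpow_pow_comm (by positivity) _ _).symm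
        _ ≤ (m : ℝ) ^ j := pow_le_pow_left₀ (by positivity) hm j
    have h := hF.mono _ _ (restricts_matMul_of_le (K := K) (a := a ^ i) (a' := n ^ j)
      (by exact_mod_cast han) (b := a ^ i) (b' := n ^ j) (by exact_mod_cast han)
      (c := b ^ i) (c' := m ^ j) (by exact_mod_cast hbm))
    rw [hF.matMul_pow, hF.matMul_pow] at h
    have h' := Real.log_le_log (pow_pos (by linarith) _) h
    rw [Real.log_pow, Real.log_pow, ← hx, ← hy] at h'
    nlinarith [mul_le_mul_of_nonneg_left hi2 hx0, mul_le_mul_of_nonneg_right h' hla.le]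
  rw [Real.logb, Real.logb, div_le_div_iff₀ hla hln]
  by_contra! hlt
  obtain ⟨j, hj⟩ := exists_nat_gt (x * Real.log a / (x * Real.log n - y * Real.log a))
  rw [div_lt_iff₀ (by linarith)] at hj
  linarith [key j]

theorem quasiValues_pos {P v : ℝ} (h : v ∈ quasiValues F P) : 0 < v := by
  obtain ⟨a, b, -, -, rfl⟩ := h
  positivity

theorem two_le_of_mem_quasiValues (hF : IsBarrierFunctional F) {P v : ℝ} (hP : 0 ≤ P)
    (h : v ∈ quasiValues F P) : 2 ≤ v := by
  obtain ⟨a, b, ha, hab, rfl⟩ := h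
  have ha' : (2 : ℝ) ≤ a := by exact_mod_cast ha
  have hb1 : 1 ≤ b := by
    exact_mod_cast (Real.one_le_rpow (by linarith : (1 : ℝ) ≤ a) hP).trans hab.le
  have h1 : 1 ≤ Real.logb a (F (matMul K a a b)) := by
    rw [Real.le_logb_iff_rpow_le (by linarith) (by linarith [hF.le_matMul (K := K) a hb1]),
      Real.rpow_one]
    exact hF.le_matMul a hb1
  simpa using Real.rpow_le_rpow_of_exponent_le one_le_two h1

theorem logb_quasi_le (hF : IsBarrierFunctional F) {p : ℝ} (hp : 0 ≤ p) {n m : ℕ}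
    (hn : 2 ≤ n) (hm : (n : ℝ) ^ p ≤ m) :
    Real.logb 2 (quasi F p) ≤ Real.logb n (F (matMul K n n m)) := by
  have hn' : (2 : ℝ) ≤ n := by exact_mod_cast hn
  have hm1 : (1 : ℝ) ≤ m := (Real.one_le_rpow (by linarith : (1 : ℝ) ≤ n) hp).trans hm
  have hbdd : ∀ S : Set ℝ, (∀ v ∈ S, 0 < v) → BddBelow S :=
    fun S hS => ⟨0, fun v hv => (hS v hv).le⟩
  rw [quasi]
  split_ifs with hne
  · obtain ⟨v, hv⟩ := hne
    have h2 : 2 ≤ sInf (quasiValues F p) :=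
      le_csInf ⟨v, hv⟩ fun w hw => hF.two_le_of_mem_quasiValues hp hw
    refine (Real.logb_le_logb_of_le one_lt_two (by linarith)
      (csInf_le (hbdd _ fun w hw => quasiValues_pos hw) hv)).trans ?_
    obtain ⟨a, b, ha, hab, rfl⟩ := hv
    rw [Real.logb_rpow (by norm_num) (by norm_num)]
    exact hF.logb_matMul_le hp ha hab hn hm
  · have hP : p ≤ Real.logb n m := by
      rwa [Real.le_logb_iff_rpow_le (by linarith) (by linarith)]
    have hmem : (2 : ℝ) ^ Real.logb n (F (matMul K n n m)) ∈
        {v | ∃ P : ℝ, p ≤ P ∧ v ∈ quasiValues F P} :=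
      ⟨_, hP, n, m, hn, Real.rpow_logb (by linarith) (by linarith) (by linarith), rfl⟩
    have h2 : 2 ≤ sInf {v | ∃ P : ℝ, p ≤ P ∧ v ∈ quasiValues F P} :=
      le_csInf ⟨_, hmem⟩ fun w ⟨P, hP, hw⟩ => hF.two_le_of_mem_quasiValues (hp.trans hP) hw
    refine (Real.logb_le_logb_of_le one_lt_two (by linarith)
      (csInf_le (hbdd _ fun w hw => quasiValues_pos hw.choose_spec.2) hmem)).trans ?_
    rw [Real.logb_rpow (by norm_num) (by norm_num)]

variable {p : ℝ} {T : Tensor3 K}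

theorem mul_le_pow (hF : IsBarrierFunctional F) (M : TMethod T p) {R : Params}
    (hR : R ∈ M.reductions) : R.s * F (matMul K R.n R.n R.m) ≤ F T ^ R.k := by
  rw [← hF.dsumPow]
  exact (hF.mono _ _ (M.restricts R hR)).trans (hF.kronPow_le T _)

theorem one_le_m (M : TMethod T p) (hp : 0 ≤ p) {R : Params} (hR : R ∈ M.reductions) :
    1 ≤ R.m := by
  have h : (2 : ℝ) ≤ R.n := by exact_mod_cast M.two_le R hR
  exact_mod_cast (Real.one_le_rpow (by linarith : (1 : ℝ) ≤ R.n) hp).trans (M.rpow_le R hR)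

theorem one_lt (hF : IsBarrierFunctional F) (hp : 0 ≤ p) (M : TMethod T p) : 1 < F T := by
  obtain ⟨R, hR⟩ := M.nonempty
  have h1 := hF.mul_le_pow M hR
  have h2 := hF.le_matMul (K := K) R.n (one_le_m M hp hR)
  have hn : (2 : ℝ) ≤ R.n := by exact_mod_cast M.two_le R hR
  have hs : (1 : ℝ) ≤ R.s := by exact_mod_cast M.one_le R hR
  by_contra! h
  have := pow_le_one₀ (n := R.k) (hF.nonneg T) h
  nlinarith

/-- The barrier for a single inequality, with its dependence on the number `s` of summands. -/
theorem le_bound (hF : IsBarrierFunctional F) (hp : 0 ≤ p) (M : TMethod T p) {R : Params}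
    (hR : R ∈ M.reductions) :
    Real.logb 2 (quasi F p) * Real.logb 2 T.asymptoticRank / Real.logb 2 (F T) +
      (Real.logb 2 T.asymptoticRank / Real.logb 2 (F T) - 1) * Real.logb R.n R.s ≤ M.bound R := by
  have hn : (2 : ℝ) ≤ R.n := by exact_mod_cast M.two_le R hR
  have hs : (1 : ℝ) ≤ R.s := by exact_mod_cast M.one_le R hR
  have hFm := hF.le_matMul (K := K) R.n (one_le_m M hp hR)
  have hln : 0 < Real.log R.n := Real.log_pos (by linarith)
  have hFT := hF.one_lt hp M
  have hf : 0 < Real.log (F T) := Real.log_pos hFT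
  have hrank := hF.le_asymptoticRank T
  have hq := hF.logb_quasi_le hp (M.two_le R hR) (M.rpow_le R hR)
  have hk : Real.log R.s + Real.log (F (matMul K R.n R.n R.m)) ≤ R.k * Real.log (F T) := by
    rw [← Real.log_mul (by linarith) (by linarith), ← Real.log_pow]
    exact Real.log_le_log (mul_pos (by linarith) (by linarith)) (hF.mul_le_pow M hR)
  have hr : Real.log T.asymptoticRank ≤ Real.log M.r :=
    Real.log_le_log (by linarith) M.asymptoticRank_le
  have hL : 0 ≤ Real.log T.asymptoticRank := Real.log_nonneg (by linarith)
  have hρ : Real.logb 2 T.asymptoticRank / Real.logb 2 (F T) =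
      Real.log T.asymptoticRank / Real.log (F T) := by
    have : Real.log 2 ≠ 0 := (Real.log_pos one_lt_two).ne'
    simp only [Real.logb]
    field_simp
  rw [mul_div_assoc, hρ]
  set ρ := Real.log T.asymptoticRank / Real.log (F T) with hρdef
  have hρ0 : 0 ≤ ρ := by positivity
  have hρf : ρ * Real.log (F T) = Real.log T.asymptoticRank := div_mul_cancel₀ _ hf.ne'
  set q := Real.logb 2 (quasi F p)
  rw [Real.logb, le_div_iff₀ hln] at hq
  have e1 : M.bound R = (R.k * Real.log M.r - Real.log R.s) / Real.log R.n := by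
    simp only [TMethod.bound, Real.logb]; ring
  rw [e1, le_div_iff₀ hln, add_mul, Real.logb, mul_assoc (ρ - 1),
    div_mul_cancel₀ _ hln.ne']
  have h1 := mul_le_mul_of_nonneg_left hr (Nat.cast_nonneg (α := ℝ) R.k)
  have h2 := mul_le_mul_of_nonneg_left hk hρ0
  have h3 := mul_le_mul_of_nonneg_left hq hρ0
  rw [← hρf] at h1
  linarith

/-- If `log R̃(T) > log F(T)`, then only finitely many values of the bound that come from `n ≤ N`
lie below a given number: the barrier bounds `s`, and then `k`. -/
theorem finite_bounds (hF : IsBarrierFunctional F) (hp : 0 ≤ p) (M : TMethod T p)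
    (hρ : 1 < Real.logb 2 T.asymptoticRank / Real.logb 2 (F T)) (N : ℕ) (c : ℝ) :
    (M.bound '' {R ∈ M.reductions | R.n ≤ N ∧ M.bound R ≤ c}).Finite := by
  set ρ := Real.logb 2 T.asymptoticRank / Real.logb 2 (F T)
  set B := Real.logb 2 (quasi F p) * Real.logb 2 T.asymptoticRank / Real.logb 2 (F T)
  have hr : 0 < Real.log M.r := Real.log_pos
    ((hF.one_lt hp M).trans_le ((hF.le_asymptoticRank T).trans M.asymptoticRank_le))
  set D := max 0 ((c - B) / (ρ - 1)) * Real.log N with hD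
  set E := (max 0 c * Real.log N + D) / Real.log M.r with hE
  refine Set.Finite.subset (((Set.finite_Iic (N, ⌊Real.exp D⌋₊, ⌊E⌋₊))).image
    fun x => x.2.2 * Real.logb x.1 M.r - Real.logb x.1 x.2.1) ?_
  rintro _ ⟨R, ⟨hR, hRN, hRc⟩, rfl⟩
  have hn : (2 : ℝ) ≤ R.n := by exact_mod_cast M.two_le R hR
  have hs : (1 : ℝ) ≤ R.s := by exact_mod_cast M.one_le R hR
  have hln : 0 < Real.log R.n := Real.log_pos (by linarith)
  have hlN : Real.log R.n ≤ Real.log N := Real.log_le_log (by linarith) (by exact_mod_cast hRN)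
  have h1 := hF.le_bound hp M hR
  have h2 : Real.logb R.n R.s ≤ (c - B) / (ρ - 1) := by
    rw [le_div_iff₀ (by linarith)]; linarith
  have h3 : Real.log R.s ≤ D := by
    rw [Real.logb, div_le_iff₀ hln] at h2
    refine h2.trans (mul_le_mul (le_max_right _ _) hlN hln.le (le_max_left _ _))
  have h4 : (R.k : ℝ) ≤ E := by
    rw [hE, le_div_iff₀ hr]
    have h5 : M.bound R * Real.log R.n = R.k * Real.log M.r - Real.log R.s := by
      simp only [TMethod.bound, Real.logb]; field_simp
    have h6 : M.bound R * Real.log R.n ≤ max 0 c * Real.log N :=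
      (mul_le_mul_of_nonneg_right (hRc.trans (le_max_right _ _)) hln.le).trans
        (mul_le_mul_of_nonneg_left hlN (le_max_left _ _))
    linarith
  refine ⟨(R.n, R.s, R.k), ⟨hRN, Nat.le_floor ?_, Nat.le_floor h4⟩, rfl⟩
  rwa [← Real.log_le_iff_le_exp (by linarith)]

theorem bddBelow_bound_and_le_omegaHat (hF : IsBarrierFunctional F) (hp : 0 ≤ p)
    (M : TMethod T p) : BddBelow (M.bound '' M.reductions) ∧
    Real.logb 2 (quasi F p) * Real.logb 2 T.asymptoticRank / Real.logb 2 (F T) ≤ M.omegaHat := by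
  have h : ∀ v ∈ M.bound '' M.reductions,
      Real.logb 2 (quasi F p) * Real.logb 2 T.asymptoticRank / Real.logb 2 (F T) ≤ v := by
    rintro _ ⟨R, hR, rfl⟩
    have hFT := hF.one_lt hp M
    have hf : 0 < Real.logb 2 (F T) := Real.logb_pos one_lt_two hFT
    have hρ : 1 ≤ Real.logb 2 T.asymptoticRank / Real.logb 2 (F T) := by
      rw [one_le_div hf]
      exact Real.logb_le_logb_of_le one_lt_two (by linarith) (hF.le_asymptoticRank T)
    have hs : 0 ≤ Real.logb R.n R.s := Real.logb_nonneg
      (by exact_mod_cast M.two_le R hR) (by exact_mod_cast M.one_le R hR)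
    nlinarith [hF.le_bound hp M hR]
  exact ⟨⟨_, h⟩, le_csInf (M.nonempty.image _) h⟩

theorem le_omegaHat_of_isCatalytic (hF : IsBarrierFunctional F) (hp : 0 ≤ p)
    (M : TMethod T p) {κ : ℝ} (hM : M.IsCatalytic κ) :
    Real.logb 2 (quasi F p) * Real.logb 2 T.asymptoticRank / Real.logb 2 (F T)
      + κ * (Real.logb 2 T.asymptoticRank / Real.logb 2 (F T) - 1) ≤ M.omegaHat := by
  obtain ⟨-, hatt, C, hC, hs⟩ := hM
  obtain ⟨hbdd, hle⟩ := hF.bddBelow_bound_and_le_omegaHat hp M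
  have hFT := hF.one_lt hp M
  have hρ : 1 ≤ Real.logb 2 T.asymptoticRank / Real.logb 2 (F T) := by
    rw [one_le_div (Real.logb_pos one_lt_two hFT)]
    exact Real.logb_le_logb_of_le one_lt_two (by linarith) (hF.le_asymptoticRank T)
  rcases hρ.eq_or_lt with hρ | hρ
  · rw [← hρ]; linarith
  have hfin := hF.finite_bounds hp M hρ
  have hbound := fun R hR => hF.le_bound hp M (R := R) hR
  set ρ := Real.logb 2 T.asymptoticRank / Real.logb 2 (F T)
  set B := Real.logb 2 (quasi F p) * Real.logb 2 T.asymptoticRank / Real.logb 2 (F T)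
  by_contra! hlt
  set c := (M.omegaHat + (B + κ * (ρ - 1))) / 2 with hc
  set δ := (B + κ * (ρ - 1) - c) / (ρ - 1) with hδ
  have hδ0 : 0 < δ := div_pos (by linarith) (by linarith)
  obtain ⟨N, hN⟩ := exists_nat_ge (Real.exp (-Real.log C / δ))
  -- an inequality whose bound is close to the infimum has bounded `n`
  have hsmall : ∀ R ∈ M.reductions, M.bound R ≤ c → R.n ≤ N := by
    intro R hR hRc
    have hn : (2 : ℝ) ≤ R.n := by exact_mod_cast M.two_le R hR
    have hln : 0 < Real.log R.n := Real.log_pos (by linarith)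
    have h1 : Real.log C + κ * Real.log R.n ≤ Real.log R.s := by
      rw [← Real.log_rpow (by linarith), ← Real.log_mul hC.ne' (by positivity)]
      exact Real.log_le_log (by positivity) (hs R hR)
    have h2 : (ρ - 1) * Real.logb R.n R.s ≤ c - B := by linarith [hbound R hR]
    have h3 : Real.logb R.n R.s ≤ κ - δ := by
      have : κ - δ = (c - B) / (ρ - 1) := by
        rw [hδ]; field_simp [show ρ - 1 ≠ 0 by linarith]; ring
      rw [this, le_div_iff₀ (by linarith)]; linarith
    rw [Real.logb, div_le_iff₀ hln] at h3
    have h4 : Real.log R.n ≤ -Real.log C / δ := by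
      rw [le_div_iff₀ hδ0]; linarith
    rw [Real.log_le_iff_le_exp (by linarith)] at h4
    exact_mod_cast h4.trans hN
  obtain ⟨_, ⟨R₀, hR₀, rfl⟩, hR₀c⟩ := exists_lt_of_csInf_lt (M.nonempty.image M.bound)
    (show sInf (M.bound '' M.reductions) < c by rw [← TMethod.omegaHat]; linarith)
  obtain ⟨v, ⟨R, ⟨hR, -, hRc⟩, rfl⟩, hmin⟩ := (hfin N c).exists_minimal
    ⟨_, R₀, ⟨hR₀, hsmall R₀ hR₀ hR₀c.le, hR₀c.le⟩, rfl⟩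
  -- the smallest of these finitely many values is the infimum
  refine hatt ⟨R, hR, le_antisymm (le_csInf (M.nonempty.image _) ?_) (csInf_le hbdd ⟨R, hR, rfl⟩)⟩
  rintro _ ⟨R', hR', rfl⟩
  by_contra! h
  exact absurd (hmin ⟨R', ⟨hR', hsmall R' hR' (h.le.trans hRc), h.le.trans hRc⟩, rfl⟩ h.le)
    (not_le.2 h)

end IsBarrierFunctional

/-! ### Trilinear maps in coordinates -/

section Trilin

variable {K I J L : Type*} [Field K] [Fintype I] [Fintype J] [Fintype L] (t : I → J → L → K)

theorem isLinearMap_trilin_left (y : J → K) (z : L → K) :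
    IsLinearMap K fun x => trilin t x y z where
  map_add x x' := by simp [trilin, mul_add, add_mul, Finset.sum_add_distrib]
  map_smul c x := by
    simp only [trilin, Finset.mul_sum, Pi.smul_apply, smul_eq_mul]
    refine Finset.sum_congr rfl fun i _ => Finset.sum_congr rfl fun j _ =>
      Finset.sum_congr rfl fun l _ => by ring

theorem isLinearMap_trilin_mid (x : I → K) (z : L → K) :
    IsLinearMap K fun y => trilin t x y z where
  map_add x x' := by simp [trilin, mul_add, add_mul, Finset.sum_add_distrib]
  map_smul c x := by
    simp only [trilin, Finset.mul_sum, Pi.smul_apply, smul_eq_mul]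
    refine Finset.sum_congr rfl fun i _ => Finset.sum_congr rfl fun j _ =>
      Finset.sum_congr rfl fun l _ => by ring

theorem isLinearMap_trilin_right (x : I → K) (y : J → K) :
    IsLinearMap K fun z => trilin t x y z where
  map_add x x' := by simp [trilin, mul_add, Finset.sum_add_distrib]
  map_smul c x := by
    simp only [trilin, Finset.mul_sum, Pi.smul_apply, smul_eq_mul]
    refine Finset.sum_congr rfl fun i _ => Finset.sum_congr rfl fun j _ =>
      Finset.sum_congr rfl fun l _ => by ring

/-- The coefficient array of a trilinear map with respect to vectors `a i`, `b j`, `c l`. -/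
theorem trilin_sum_smul {X Y Z : Type*} [Fintype X] [Fintype Y] [Fintype Z] (a : X → I → K)
    (b : Y → J → K) (c : Z → L → K) (x : X → K) (y : Y → K) (z : Z → K) :
    trilin t (∑ i, x i • a i) (∑ j, y j • b j) (∑ l, z l • c l) =
      trilin (fun i j l => trilin t (a i) (b j) (c l)) x y z := by
  have h1 := fun y z => map_sum ((isLinearMap_trilin_left t y z).mk' _) (fun i => x i • a i)
    Finset.univ
  have h2 := fun x z => map_sum ((isLinearMap_trilin_mid t x z).mk' _) (fun i => y i • b i)
    Finset.univ
  have h3 := fun x y => map_sum ((isLinearMap_trilin_right t x y).mk' _) (fun i => z i • c i)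
    Finset.univ
  simp only [map_smul, IsLinearMap.mk'_apply, smul_eq_mul] at h1 h2 h3
  rw [h1]
  simp only [h2, h3, Finset.mul_sum]
  rw [trilin]
  refine Finset.sum_congr rfl fun i _ => Finset.sum_congr rfl fun j _ =>
    Finset.sum_congr rfl fun l _ => by ring

theorem exists_ne_zero_of_trilin_ne_zero {x : I → K} {y : J → K} {z : L → K}
    (h : trilin t x y z ≠ 0) : ∃ i j l, t i j l ≠ 0 ∧ x i ≠ 0 ∧ y j ≠ 0 ∧ z l ≠ 0 := by
  obtain ⟨i, -, h⟩ := Finset.exists_ne_zero_of_sum_ne_zero h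
  obtain ⟨j, -, h⟩ := Finset.exists_ne_zero_of_sum_ne_zero h
  obtain ⟨l, -, h⟩ := Finset.exists_ne_zero_of_sum_ne_zero h
  exact ⟨i, j, l, by aesop⟩

end Trilin

/-! ### Bases adapted to two flags -/

/-- Elimination: a family `v` becomes, after a unitriangular change, a family `f` for which
the largest weights `p k` met on the supports of the `f x` are charged to distinct coordinates.
The first vector keeps its heaviest coordinate and clears it from all later vectors. -/
theorem exists_triangular_finset {K X κ E : Type*} [Field K] [LinearOrder X] [Fintype κ]
    [AddCommGroup E] [Module K E] (φ : κ → E →ₗ[K] K) (s : Finset X) :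
    ∀ (v : X → E) (p : κ → ℝ), (∀ k, 0 ≤ p k) → ∃ (f : X → E) (p' : X → ℝ),
      (∀ x ∈ s, f x - v x ∈ Submodule.span K (v '' Set.Iio x)) ∧ (∀ x ∈ s, 0 ≤ p' x) ∧
      ∑ x ∈ s, p' x ≤ ∑ k, p k ∧ ∀ x ∈ s, ∀ k, φ k (f x) ≠ 0 → p k ≤ p' x := by
  classical
  induction s using Finset.induction_on_min with
  | empty =>
    exact fun v p hp => ⟨v, 0, by simp, by simp,
      by simpa using Finset.sum_nonneg fun k _ => hp k, by simp⟩
  | insert a s has ih =>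
    intro v p hp
    have ha : a ∉ s := fun h => lt_irrefl _ (has a h)
    have hne : ∀ x ∈ s, x ≠ a := fun x hx => (has x hx).ne'
    by_cases h : ∃ k, φ k (v a) ≠ 0
    · obtain ⟨k₀, hk₀, hmax⟩ := Finset.exists_max_image {k | φ k (v a) ≠ 0} p
        (by obtain ⟨k, hk⟩ := h; exact ⟨k, by simpa using hk⟩)
      simp only [Finset.mem_filter, Finset.mem_univ, true_and] at hk₀ hmax
      set v' : X → E := fun y => v y - (φ k₀ (v y) / φ k₀ (v a)) • v a with hv'
      have hv'0 : ∀ y, φ k₀ (v' y) = 0 := fun y => by simp [hv', hk₀]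
      obtain ⟨f, p', h1, h2, h3, h4⟩ := ih v' (Function.update p k₀ 0) fun k => by
        by_cases hk : k = k₀ <;> simp [hk, hp]
      refine ⟨fun x => if x = a then v a else f x, fun x => if x = a then p k₀ else p' x,
        ?_, ?_, ?_, ?_⟩
      · intro x hx
        rcases Finset.mem_insert.1 hx with rfl | hx
        · simp
        · have hav : ∀ c : K, c • v a ∈ Submodule.span K (v '' Set.Iio x) := fun c =>
            Submodule.smul_mem _ _ (Submodule.subset_span ⟨a, has x hx, rfl⟩)
          have hsub : Submodule.span K (v' '' Set.Iio x) ≤ Submodule.span K (v '' Set.Iio x) := by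
            rw [Submodule.span_le]
            rintro _ ⟨y, hy, rfl⟩
            exact Submodule.sub_mem _ (Submodule.subset_span ⟨y, hy, rfl⟩) (hav _)
          have := Submodule.sub_mem _ (hsub (h1 x hx)) (hav (φ k₀ (v x) / φ k₀ (v a)))
          simp only [hne x hx, if_false]
          convert this using 1
          simp only [hv']
          abel
      · intro x hx
        rcases Finset.mem_insert.1 hx with rfl | hx
        · simp [hp]
        · simpa [hne x hx] using h2 x hx
      · rw [Finset.sum_insert ha, if_pos rfl, Finset.sum_congr rfl fun x hx => if_neg (hne x hx)]
        rw [Finset.sum_update_of_mem (Finset.mem_univ k₀)] at h3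
        rw [← Finset.add_sum_erase _ _ (Finset.mem_univ k₀), Finset.erase_eq]
        linarith
      · intro x hx k hk
        rcases Finset.mem_insert.1 hx with rfl | hx
        · simp only [if_true] at hk ⊢
          exact hmax k hk
        · simp only [hne x hx, if_false] at hk ⊢
          have hker : Submodule.span K (v' '' Set.Iio x) ≤ LinearMap.ker (φ k₀) := by
            rw [Submodule.span_le]
            rintro _ ⟨y, -, rfl⟩
            exact hv'0 y
          have hfx : φ k₀ (f x) = 0 := by
            have := hker (h1 x hx)
            rwa [LinearMap.mem_ker, map_sub, hv'0, sub_zero] at this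
          have hkk : k ≠ k₀ := fun e => hk (e ▸ hfx)
          simpa [Function.update_apply, hkk] using h4 x hx k hk
    · push Not at h
      obtain ⟨f, p', h1, h2, h3, h4⟩ := ih v p hp
      refine ⟨fun x => if x = a then v a else f x, fun x => if x = a then 0 else p' x,
        ?_, ?_, ?_, ?_⟩
      · intro x hx
        rcases Finset.mem_insert.1 hx with rfl | hx
        · simp
        · simpa [hne x hx] using h1 x hx
      · intro x hx
        rcases Finset.mem_insert.1 hx with rfl | hx
        · simp
        · simpa [hne x hx] using h2 x hx
      · rw [Finset.sum_insert ha, if_pos rfl, Finset.sum_congr rfl fun x hx => if_neg (hne x hx)]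
        linarith
      · intro x hx k hk
        rcases Finset.mem_insert.1 hx with rfl | hx
        · simp [h] at hk
        · simp only [hne x hx, if_false] at hk ⊢
          exact h4 x hx k hk

theorem span_le_of_triangular {K X E : Type*} [Field K] [LinearOrder X] [WellFoundedLT X]
    [AddCommGroup E] [Module K E] {f v : X → E}
    (h : ∀ x, f x - v x ∈ Submodule.span K (v '' Set.Iio x)) :
    Submodule.span K (Set.range v) ≤ Submodule.span K (Set.range f) := by
  rw [Submodule.span_le]
  rintro _ ⟨x, rfl⟩
  induction x using WellFoundedLT.induction with
  | ind x ih =>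
    have h1 : Submodule.span K (v '' Set.Iio x) ≤ Submodule.span K (Set.range f) := by
      rw [Submodule.span_le]
      rintro _ ⟨y, hy, rfl⟩
      exact ih y hy
    have := Submodule.sub_mem _ (Submodule.subset_span (Set.mem_range_self x)) (h1 (h x))
    rwa [sub_sub_cancel] at this

/-- A basis that is unitriangular with respect to the given one and whose leading weights under `φ`
are charged to distinct coordinates. For the coordinates `φ` of a second basis, this is a basis
adapted to two flags (Bruhat decomposition). -/
theorem exists_adapted_basis {K X κ E : Type*} [Field K] [LinearOrder X] [Fintype X] [Fintype κ]
    [AddCommGroup E] [Module K E] (v : Module.Basis X K E) (φ : κ → E →ₗ[K] K) (p : κ → ℝ)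
    (hp : ∀ k, 0 ≤ p k) : ∃ (f : Module.Basis X K E) (p' : X → ℝ),
      (∀ x, f x - v x ∈ Submodule.span K (v '' Set.Iio x)) ∧ (∀ x, 0 ≤ p' x) ∧
      ∑ x, p' x ≤ ∑ k, p k ∧ ∀ x k, φ k (f x) ≠ 0 → p k ≤ p' x := by
  obtain ⟨f, p', h1, h2, h3, h4⟩ := exists_triangular_finset φ Finset.univ v p hp
  simp only [Finset.mem_univ, true_imp_iff] at h1 h2 h4
  have hs : ⊤ ≤ Submodule.span K (Set.range f) := v.span_eq.ge.trans (span_le_of_triangular h1)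
  refine ⟨basisOfTopLeSpanOfCardEqFinrank f hs (Module.finrank_eq_card_basis v).symm, p', ?_, h2,
    h3, ?_⟩
  · simpa using h1
  · simpa using h4

/-! ### Weighted geometric means -/

/-- The weighted geometric mean `x ^ θ₀ * y ^ θ₁ * z ^ θ₂`. Since `0 ^ 0 = 1`, arguments with
exponent `0` are ignored, even if they vanish. -/
noncomputable def geomMean (θ : Fin 3 → ℝ) (x y z : ℝ) : ℝ := x ^ θ 0 * y ^ θ 1 * z ^ θ 2

section GeomMean

variable {θ : Fin 3 → ℝ}

theorem geomMean_nonneg {x y z : ℝ} (hx : 0 ≤ x) (hy : 0 ≤ y) (hz : 0 ≤ z) :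
    0 ≤ geomMean θ x y z := by
  unfold geomMean; positivity

theorem geomMean_mono (hθ : θ ∈ stdSimplex ℝ (Fin 3)) {x y z x' y' z' : ℝ} (hx : 0 ≤ x)
    (hy : 0 ≤ y) (hz : 0 ≤ z) (hxx : x ≤ x') (hyy : y ≤ y') (hzz : z ≤ z') :
    geomMean θ x y z ≤ geomMean θ x' y' z' := by
  have h := hθ.1
  have hx' := hx.trans hxx
  have hy' := hy.trans hyy
  unfold geomMean
  gcongr
  exacts [h 0, h 1, h 2]

theorem geomMean_mul {x y z x' y' z' : ℝ} (hx : 0 ≤ x) (hy : 0 ≤ y) (hz : 0 ≤ z) (hx' : 0 ≤ x')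
    (hy' : 0 ≤ y') (hz' : 0 ≤ z') :
    geomMean θ (x * x') (y * y') (z * z') = geomMean θ x y z * geomMean θ x' y' z' := by
  simp only [geomMean, Real.mul_rpow hx hx', Real.mul_rpow hy hy', Real.mul_rpow hz hz']
  ring

theorem sum_stdSimplex_three (hθ : θ ∈ stdSimplex ℝ (Fin 3)) : θ 0 + θ 1 + θ 2 = 1 := by
  rw [← hθ.2, Fin.sum_univ_three]

theorem geomMean_self (hθ : θ ∈ stdSimplex ℝ (Fin 3)) {x : ℝ} (hx : 0 ≤ x) :
    geomMean θ x x x = x := by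
  rw [geomMean, ← Real.rpow_add_of_nonneg hx (hθ.1 0) (hθ.1 1),
    ← Real.rpow_add_of_nonneg hx (add_nonneg (hθ.1 0) (hθ.1 1)) (hθ.1 2), sum_stdSimplex_three hθ,
    Real.rpow_one]

theorem geomMean_le (hθ : θ ∈ stdSimplex ℝ (Fin 3)) {x y z : ℝ} (hx : 0 ≤ x) (hy : 0 ≤ y)
    (hz : 0 ≤ z) : geomMean θ x y z ≤ θ 0 * x + θ 1 * y + θ 2 * z :=
  Real.geom_mean_le_arith_mean3_weighted (hθ.1 0) (hθ.1 1) (hθ.1 2) hx hy hz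
    (sum_stdSimplex_three hθ)

end GeomMean

/-! ### Entropy and duality -/

theorem sum_negMulLog_eq {α : Type*} [Fintype α] (q : α → ℝ) :
    ∑ a, Real.negMulLog (q a) = entropy q * Real.log 2 := by
  rw [entropy, ← Finset.sum_div, div_mul_cancel₀ _ (Real.log_pos one_lt_two).ne']

/-- Gibbs' inequality. -/
theorem sum_mul_log_le {α : Type*} [Fintype α] {θ : ℝ} (hθ : 0 ≤ θ) {q p : α → ℝ}
    (hq : ∀ a, 0 ≤ q a) (hq1 : ∑ a, q a = 1) (hp : ∀ a, 0 ≤ p a) (hp1 : ∑ a, p a ≤ 1)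
    (h : ∀ a, q a ≠ 0 → θ ≠ 0 → p a ≠ 0) :
    ∑ a, q a * (θ * Real.log (p a)) ≤ -(θ * entropy q * Real.log 2) := by
  rcases hθ.eq_or_lt with rfl | hθ'
  · simp
  have h1 : ∀ a, q a * Real.log (p a) + Real.negMulLog (q a) ≤ p a - q a := by
    intro a
    rcases (hq a).eq_or_lt with h0 | h0
    · simp [← h0, hp a]
    · have hpa : 0 < p a := (hp a).lt_of_ne (h a h0.ne' hθ'.ne').symm
      have h2 := Real.log_le_sub_one_of_pos (div_pos hpa h0)
      rw [Real.log_div hpa.ne' h0.ne'] at h2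
      have h3 := mul_le_mul_of_nonneg_left h2 h0.le
      have h4 : q a * (p a / q a - 1) = p a - q a := by field_simp
      rw [Real.negMulLog]
      linarith
  have h2 := Finset.sum_le_sum fun a (_ : a ∈ Finset.univ) => h1 a
  rw [Finset.sum_add_distrib, Finset.sum_sub_distrib, hq1] at h2
  have h4 : ∑ a, q a * (θ * Real.log (p a)) = θ * ∑ a, q a * Real.log (p a) := by
    rw [Finset.mul_sum]; exact Finset.sum_congr rfl fun a _ => by ring
  rw [h4, mul_assoc, ← sum_negMulLog_eq, ← mul_neg]
  exact mul_le_mul_of_nonneg_left (by linarith) hθ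

theorem log_rpow_of_ne_zero {x y : ℝ} (hx : 0 ≤ x) (h : x ^ y ≠ 0) :
    Real.log (x ^ y) = y * Real.log x := by
  rcases hx.eq_or_lt with rfl | hx
  · have : y = 0 := by
      by_contra hy
      exact h (Real.zero_rpow hy)
    simp [this]
  · exact Real.log_rpow hx y

section Duality

variable {K I J L : Type*} [Field K] [Fintype I] [Fintype J] [Fintype L] {θ : Fin 3 → ℝ}

theorem supportValue_nonneg (t : I → J → L → K) : 0 ≤ supportValue θ t := by
  refine Real.sSup_nonneg ?_
  rintro _ ⟨P, -, -, rfl⟩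
  positivity

/-- Weak duality: weights on the three index sets bound the entropies of all probability vectors
on the support. -/
theorem supportValue_le (hθ : θ ∈ stdSimplex ℝ (Fin 3)) {t : I → J → L → K} {M : ℝ} (hM : 0 ≤ M)
    {p : I → ℝ} {q : J → ℝ} {r : L → ℝ} (hp : ∀ i, 0 ≤ p i) (hq : ∀ j, 0 ≤ q j)
    (hr : ∀ l, 0 ≤ r l) (hp1 : ∑ i, p i ≤ 1) (hq1 : ∑ j, q j ≤ 1) (hr1 : ∑ l, r l ≤ 1)
    (h : ∀ i j l, t i j l ≠ 0 → 1 ≤ M * geomMean θ (p i) (q j) (r l)) : supportValue θ t ≤ M := by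
  refine Real.sSup_le ?_ hM
  rintro _ ⟨P, ⟨hP0, hP1⟩, hPt, rfl⟩
  have hP1' : ∑ i, ∑ j, ∑ l, P (i, j, l) = 1 := by
    simpa only [Fintype.sum_prod_type] using hP1
  have hPpos : ∀ {i j l}, P (i, j, l) ≠ 0 → 1 ≤ M * geomMean θ (p i) (q j) (r l) :=
    fun {i j l} hne => h i j l fun h0 => hne (hPt i j l h0)
  have hMpos : 0 < M := by
    refine hM.lt_of_ne fun h0 => ?_
    have : ∑ x, P x = 0 := Finset.sum_eq_zero fun ⟨i, j, l⟩ _ => by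
      by_contra hne
      have := hPpos hne
      rw [← h0] at this
      linarith
    linarith
  have hfac : ∀ {i j l}, P (i, j, l) ≠ 0 → p i ^ θ 0 ≠ 0 ∧ q j ^ θ 1 ≠ 0 ∧ r l ^ θ 2 ≠ 0 := by
    intro i j l hne
    have h1 := hPpos hne
    have h2 : geomMean θ (p i) (q j) (r l) ≠ 0 := fun h0 => by rw [h0] at h1; linarith
    simpa [geomMean, and_assoc] using h2
  have hrne : ∀ {x y : ℝ}, x ^ y ≠ 0 → y ≠ 0 → x ≠ 0 := fun hxy hy hx =>
    hxy (by rw [hx, Real.zero_rpow hy])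
  have key : ∀ i j l, 0 ≤ P (i, j, l) * (Real.log M + (θ 0 * Real.log (p i) +
      θ 1 * Real.log (q j) + θ 2 * Real.log (r l))) := by
    intro i j l
    by_cases hne : P (i, j, l) = 0
    · simp [hne]
    · obtain ⟨h1, h2, h3⟩ := hfac hne
      refine mul_nonneg (hP0 _) ?_
      rw [← log_rpow_of_ne_zero (hp i) h1, ← log_rpow_of_ne_zero (hq j) h2,
        ← log_rpow_of_ne_zero (hr l) h3, ← Real.log_mul h1 h2,
        ← Real.log_mul (mul_ne_zero h1 h2) h3,
        ← Real.log_mul hMpos.ne' (mul_ne_zero (mul_ne_zero h1 h2) h3)]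
      exact Real.log_nonneg (hPpos hne)
  have hsum : 0 ≤ Real.log M + (∑ i, (∑ j, ∑ l, P (i, j, l)) * (θ 0 * Real.log (p i)) +
      ∑ j, (∑ i, ∑ l, P (i, j, l)) * (θ 1 * Real.log (q j)) +
      ∑ l, (∑ i, ∑ j, P (i, j, l)) * (θ 2 * Real.log (r l))) := by
    have h1 := Finset.sum_nonneg fun i (_ : i ∈ Finset.univ) => Finset.sum_nonneg
      fun j (_ : j ∈ Finset.univ) => Finset.sum_nonneg fun l (_ : l ∈ Finset.univ) => key i j l
    simp only [mul_add, Finset.sum_add_distrib] at h1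
    have e0 : ∑ i, ∑ j, ∑ l, P (i, j, l) * Real.log M = Real.log M := by
      simp only [← Finset.sum_mul, hP1', one_mul]
    have e1 : ∑ i, ∑ j, ∑ l, P (i, j, l) * (θ 0 * Real.log (p i)) =
        ∑ i, (∑ j, ∑ l, P (i, j, l)) * (θ 0 * Real.log (p i)) := by
      simp only [Finset.sum_mul]
    have e2 : ∑ i, ∑ j, ∑ l, P (i, j, l) * (θ 1 * Real.log (q j)) =
        ∑ j, (∑ i, ∑ l, P (i, j, l)) * (θ 1 * Real.log (q j)) := by
      rw [Finset.sum_comm]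
      simp only [Finset.sum_mul]
    have e3 : ∑ i, ∑ j, ∑ l, P (i, j, l) * (θ 2 * Real.log (r l)) =
        ∑ l, (∑ i, ∑ j, P (i, j, l)) * (θ 2 * Real.log (r l)) := by
      rw [Finset.sum_congr rfl fun i _ => Finset.sum_comm, Finset.sum_comm]
      simp only [Finset.sum_mul]
    rw [e0, e1, e2, e3] at h1
    exact h1
  have g1 := sum_mul_log_le (hθ.1 0) (q := fun i => ∑ j, ∑ l, P (i, j, l)) (p := p)
    (fun i => Finset.sum_nonneg fun j _ => Finset.sum_nonneg fun l _ => hP0 _) hP1' hp hp1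
    fun i hi => by
      obtain ⟨j, -, hj⟩ := Finset.exists_ne_zero_of_sum_ne_zero hi
      obtain ⟨l, -, hl⟩ := Finset.exists_ne_zero_of_sum_ne_zero hj
      exact hrne (hfac hl).1
  have g2 := sum_mul_log_le (hθ.1 1) (q := fun j => ∑ i, ∑ l, P (i, j, l)) (p := q)
    (fun i => Finset.sum_nonneg fun j _ => Finset.sum_nonneg fun l _ => hP0 _)
    (by rw [Finset.sum_comm]; exact hP1') hq hq1
    fun i hi => by
      obtain ⟨j, -, hj⟩ := Finset.exists_ne_zero_of_sum_ne_zero hi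
      obtain ⟨l, -, hl⟩ := Finset.exists_ne_zero_of_sum_ne_zero hj
      exact hrne (hfac hl).2.1
  have g3 := sum_mul_log_le (hθ.1 2) (q := fun l => ∑ i, ∑ j, P (i, j, l)) (p := r)
    (fun i => Finset.sum_nonneg fun j _ => Finset.sum_nonneg fun l _ => hP0 _)
    (by rw [Finset.sum_comm, ← hP1']; exact Finset.sum_congr rfl fun i _ => Finset.sum_comm) hr hr1
    fun i hi => by
      obtain ⟨j, -, hj⟩ := Finset.exists_ne_zero_of_sum_ne_zero hi
      obtain ⟨l, -, hl⟩ := Finset.exists_ne_zero_of_sum_ne_zero hj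
      exact hrne (hfac hl).2.2
  rw [← Real.log_le_log_iff (by positivity) hMpos, Real.log_rpow two_pos]
  linarith

/-- Moving a fraction `t` of the mass of `q` to the point `a₀` changes the entropy, in nats, by at
 least `t` times the right-hand side, which tends to the derivative as `t → 0`. -/
theorem le_sum_negMulLog_sub {α : Type*} [Fintype α] [DecidableEq α] {q : α → ℝ}
    (hq : ∀ a, 0 ≤ q a) (hq1 : ∑ a, q a = 1) (a₀ : α) {t : ℝ} (ht : 0 < t) (ht1 : t < 1) :
    t * (-(entropy q * Real.log 2) - t - Real.log ((1 - t) * q a₀ + t)) ≤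
      entropy (fun a => (1 - t) * q a + if a = a₀ then t else 0) * Real.log 2 -
        entropy q * Real.log 2 := by
  simp only [← sum_negMulLog_eq]
  have h1 : ∑ a, Real.negMulLog ((1 - t) * q a + if a = a₀ then t else 0) =
      ∑ a, Real.negMulLog ((1 - t) * q a) +
        (Real.negMulLog ((1 - t) * q a₀ + t) - Real.negMulLog ((1 - t) * q a₀)) := by
    rw [← sub_eq_iff_eq_add', ← Finset.sum_sub_distrib, Finset.sum_eq_single a₀]
    · simp
    · intro b _ hb; simp [hb]
    · simp
  have h2 : ∑ a, Real.negMulLog ((1 - t) * q a) =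
      (1 - t) * ∑ a, Real.negMulLog (q a) + Real.negMulLog (1 - t) := by
    simp only [Real.negMulLog_mul, Finset.sum_add_distrib, ← Finset.sum_mul, ← Finset.mul_sum, hq1]
    ring
  have h3 : (1 - t) * t ≤ Real.negMulLog (1 - t) := by
    have := Real.log_le_sub_one_of_pos (show 0 < 1 - t by linarith)
    rw [Real.negMulLog]
    nlinarith
  have h4 : ∀ a b : ℝ, 0 ≤ a → a ≤ b → 0 < b →
      (b - a) * (-Real.log b - 1) ≤ Real.negMulLog b - Real.negMulLog a := by
    intro a b ha hab hb
    rcases ha.eq_or_lt with rfl | ha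
    · simp only [Real.negMulLog]; nlinarith
    · have h5 := Real.log_le_sub_one_of_pos (div_pos hb ha)
      rw [Real.log_div hb.ne' ha.ne'] at h5
      have h6 := mul_le_mul_of_nonneg_left h5 ha.le
      have h7 : a * (b / a - 1) = b - a := by field_simp
      simp only [Real.negMulLog]
      linarith
  have h5 : 0 ≤ (1 - t) * q a₀ := mul_nonneg (by linarith) (hq a₀)
  have h6 := h4 _ ((1 - t) * q a₀ + t) h5 (by linarith) (by linarith)
  rw [h1, h2]
  nlinarith

/-- Strong duality: the marginals of an entropy-maximizing probability vector on the support are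
weights for which the bound of weak duality is attained. -/
theorem exists_weights (hθ : θ ∈ stdSimplex ℝ (Fin 3)) (t : I → J → L → K) :
    ∃ (p : I → ℝ) (q : J → ℝ) (r : L → ℝ), (∀ i, 0 ≤ p i) ∧ (∀ j, 0 ≤ q j) ∧ (∀ l, 0 ≤ r l) ∧
      ∑ i, p i ≤ 1 ∧ ∑ j, q j ≤ 1 ∧ ∑ l, r l ≤ 1 ∧
      ∀ i j l, t i j l ≠ 0 → 1 ≤ supportValue θ t * geomMean θ (p i) (q j) (r l) := by
  classical
  by_cases hne : ∀ i j l, t i j l = 0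
  · exact ⟨0, 0, 0, by simp [hne]⟩
  push Not at hne
  obtain ⟨i₁, j₁, l₁, ht₁⟩ := hne
  set D : Set (I × J × L → ℝ) :=
    {P | P ∈ stdSimplex ℝ (I × J × L) ∧ ∀ i j l, t i j l = 0 → P (i, j, l) = 0} with hD
  have hcomp : IsCompact D := by
    refine (isCompact_stdSimplex ℝ (I × J × L)).inter_right
      (t := {P | ∀ i j l, t i j l = 0 → P (i, j, l) = 0}) ?_
    simp only [Set.ofPred_forall]
    exact isClosed_iInter fun i => isClosed_iInter fun j => isClosed_iInter fun l =>
      isClosed_iInter fun _ => isClosed_eq (continuous_apply _) continuous_const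
  set h : (I × J × L → ℝ) → ℝ := fun P => θ 0 * entropy (fun i => ∑ j, ∑ l, P (i, j, l)) +
      θ 1 * entropy (fun j => ∑ i, ∑ l, P (i, j, l)) +
      θ 2 * entropy (fun l => ∑ i, ∑ j, P (i, j, l)) with hh
  have hcont : Continuous h := by
    have := Real.continuous_negMulLog
    simp only [hh, entropy]
    fun_prop
  obtain ⟨P, ⟨⟨hP0, hP1⟩, hPt⟩, hmax⟩ := hcomp.exists_isMaxOn
    ⟨Pi.single (i₁, j₁, l₁) 1, single_mem_stdSimplex ℝ _, fun i j l h0 => by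
      rw [Pi.single_apply, if_neg]
      rintro ⟨⟩
      exact ht₁ h0⟩ hcont.continuousOn
  have hval : supportValue θ t = 2 ^ h P := by
    refine IsGreatest.csSup_eq ⟨⟨P, ⟨hP0, hP1⟩, hPt, rfl⟩, ?_⟩
    rintro _ ⟨Q, hQ, hQt, rfl⟩
    exact Real.rpow_le_rpow_of_exponent_le one_le_two (hmax ⟨hQ, hQt⟩)
  have hP1' : ∑ i, ∑ j, ∑ l, P (i, j, l) = 1 := by
    simpa only [Fintype.sum_prod_type] using hP1
  set p : I → ℝ := fun i => ∑ j, ∑ l, P (i, j, l) with hpdef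
  set q : J → ℝ := fun j => ∑ i, ∑ l, P (i, j, l) with hqdef
  set r : L → ℝ := fun l => ∑ i, ∑ j, P (i, j, l) with hrdef
  have hp : ∀ i, 0 ≤ p i := fun i => Finset.sum_nonneg fun j _ => Finset.sum_nonneg fun l _ => hP0 _
  have hq : ∀ i, 0 ≤ q i := fun i => Finset.sum_nonneg fun j _ => Finset.sum_nonneg fun l _ => hP0 _
  have hr : ∀ i, 0 ≤ r i := fun i => Finset.sum_nonneg fun j _ => Finset.sum_nonneg fun l _ => hP0 _
  have hp1 : ∑ i, p i = 1 := hP1'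
  have hq1 : ∑ i, q i = 1 := by rw [hqdef, Finset.sum_comm]; exact hP1'
  have hr1 : ∑ i, r i = 1 := by
    rw [hrdef, Finset.sum_comm, ← hP1']; exact Finset.sum_congr rfl fun i _ => Finset.sum_comm
  refine ⟨p, q, r, hp, hq, hr, hp1.le, hq1.le, hr1.le, fun i₀ j₀ l₀ ht₀ => ?_⟩
  have hlog2 : 0 < Real.log 2 := Real.log_pos one_lt_two
  -- the first order condition, for a perturbation of positive size `s`
  have hs : ∀ s ∈ Set.Ioo (0 : ℝ) 1, Real.exp (-(h P * Real.log 2) - s) ≤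
      geomMean θ ((1 - s) * p i₀ + s) ((1 - s) * q j₀ + s) ((1 - s) * r l₀ + s) := by
    rintro s ⟨hs0, hs1⟩
    set Q : I × J × L → ℝ := fun x => (1 - s) * P x + if x = (i₀, j₀, l₀) then s else 0 with hQ
    have hQmem : Q ∈ D := by
      refine ⟨⟨fun x => ?_, ?_⟩, fun i j l h0 => ?_⟩
      · have := mul_nonneg (sub_nonneg.2 hs1.le) (hP0 x)
        simp only [hQ]
        split_ifs <;> linarith
      · simp [hQ, Finset.sum_add_distrib, ← Finset.mul_sum, hP1]
      · have : (i, j, l) ≠ (i₀, j₀, l₀) := by rintro ⟨⟩; exact ht₀ h0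
        simp [hQ, hPt i j l h0, this]
    have e1 : (fun i => ∑ j, ∑ l, Q (i, j, l)) =
        fun i => (1 - s) * p i + if i = i₀ then s else 0 := by
      funext i
      by_cases hi : i = i₀ <;>
      simp [hQ, hi, Finset.sum_add_distrib, ← Finset.mul_sum, hpdef, ite_and]
    have e2 : (fun j => ∑ i, ∑ l, Q (i, j, l)) =
        fun j => (1 - s) * q j + if j = j₀ then s else 0 := by
      funext j
      by_cases hj : j = j₀ <;>
      simp [hQ, hj, Finset.sum_add_distrib, ← Finset.mul_sum, hqdef, ite_and]
    have e3 : (fun l => ∑ i, ∑ j, Q (i, j, l)) =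
        fun l => (1 - s) * r l + if l = l₀ then s else 0 := by
      funext l
      by_cases hl : l = l₀ <;>
      simp [hQ, hl, Finset.sum_add_distrib, ← Finset.mul_sum, hrdef, ite_and]
    have hle : h Q ≤ h P := hmax hQmem
    have f1 := le_sum_negMulLog_sub hp hp1 i₀ hs0 hs1
    have f2 := le_sum_negMulLog_sub hq hq1 j₀ hs0 hs1
    have f3 := le_sum_negMulLog_sub hr hr1 l₀ hs0 hs1
    have hy : ∀ x : ℝ, 0 ≤ x → 0 < (1 - s) * x + s := fun x hx => by
      have := mul_nonneg (sub_nonneg.2 hs1.le) hx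
      linarith
    have hhQ : h Q = θ 0 * entropy (fun i => (1 - s) * p i + if i = i₀ then s else 0) +
        θ 1 * entropy (fun i => (1 - s) * q i + if i = j₀ then s else 0) +
        θ 2 * entropy (fun i => (1 - s) * r i + if i = l₀ then s else 0) := by
      rw [← e1, ← e2, ← e3]
    have hhP : h P = θ 0 * entropy p + θ 1 * entropy q + θ 2 * entropy r := rfl
    have hθ1 := sum_stdSimplex_three hθ
    have g1 := mul_le_mul_of_nonneg_left f1 (hθ.1 0)
    have g2 := mul_le_mul_of_nonneg_left f2 (hθ.1 1)
    have g3 := mul_le_mul_of_nonneg_left f3 (hθ.1 2)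
    have hfin : s * (-(h P * Real.log 2) - s - (θ 0 * Real.log ((1 - s) * p i₀ + s) +
        θ 1 * Real.log ((1 - s) * q j₀ + s) + θ 2 * Real.log ((1 - s) * r l₀ + s))) ≤ 0 := by
      have hle' := mul_le_mul_of_nonneg_right hle hlog2.le
      rw [hhQ] at hle'
      have hss : s * s = (θ 0 + θ 1 + θ 2) * (s * s) := by rw [hθ1, one_mul]
      rw [hhP] at hle' ⊢
      linarith
    have hfin' := nonpos_of_mul_nonpos_right hfin hs0
    rw [geomMean, ← Real.exp_log (Real.rpow_pos_of_pos (hy _ (hp i₀)) (θ 0)),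
      ← Real.exp_log (Real.rpow_pos_of_pos (hy _ (hq j₀)) (θ 1)),
      ← Real.exp_log (Real.rpow_pos_of_pos (hy _ (hr l₀)) (θ 2)), ← Real.exp_add, ← Real.exp_add,
      Real.log_rpow (hy _ (hp i₀)), Real.log_rpow (hy _ (hq j₀)), Real.log_rpow (hy _ (hr l₀)),
      Real.exp_le_exp]
    linarith
  have hlim : Real.exp (-(h P * Real.log 2) - 0) ≤
      geomMean θ ((1 - 0) * p i₀ + 0) ((1 - 0) * q j₀ + 0) ((1 - 0) * r l₀ + 0) := by
    have hc := fun i => Real.continuous_rpow_const (hθ.1 i)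
    have c1 : Continuous fun s : ℝ => Real.exp (-(h P * Real.log 2) - s) := by fun_prop
    have c2 : Continuous fun s : ℝ =>
        geomMean θ ((1 - s) * p i₀ + s) ((1 - s) * q j₀ + s) ((1 - s) * r l₀ + s) := by
      unfold geomMean
      exact (((hc 0).comp (by fun_prop)).mul ((hc 1).comp (by fun_prop))).mul
        ((hc 2).comp (by fun_prop))
    refine le_of_tendsto_of_tendsto (c1.tendsto' 0 _ rfl |>.mono_left nhdsWithin_le_nhds)
      (c2.tendsto' 0 _ rfl |>.mono_left nhdsWithin_le_nhds) (b := 𝓝[>] (0 : ℝ)) ?_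
    filter_upwards [Ioo_mem_nhdsGT one_pos] with s using hs s
  simp only [sub_zero, one_mul, add_zero] at hlim
  rw [hval, Real.rpow_def_of_pos two_pos]
  calc (1 : ℝ) = Real.exp (Real.log 2 * h P) * Real.exp (-(h P * Real.log 2)) := by
        rw [← Real.exp_add, mul_comm, add_neg_cancel, Real.exp_zero]
    _ ≤ _ := mul_le_mul_of_nonneg_left hlim (Real.exp_pos _).le

end Duality

/-! ### Certificates for the upper support functional -/

/-- A certificate that `ζ^θ(T) ≤ M`: bases of the three spaces, and subprobability weights on the
three index sets, such that the weighted geometric mean of the weights is at least `1 / M` on the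
support of `T` in these bases. -/
structure Certificate {K : Type*} [Field K] (θ : Fin 3 → ℝ) (T : Tensor3 K) (M : ℝ) where
  nonneg : 0 ≤ M
  a : Module.Basis T.I K (T.I → K)
  b : Module.Basis T.J K (T.J → K)
  c : Module.Basis T.L K (T.L → K)
  p : T.I → ℝ
  q : T.J → ℝ
  r : T.L → ℝ
  p_nonneg : ∀ i, 0 ≤ p i
  q_nonneg : ∀ j, 0 ≤ q j
  r_nonneg : ∀ l, 0 ≤ r l
  p_sum : ∑ i, p i ≤ 1
  q_sum : ∑ j, q j ≤ 1
  r_sum : ∑ l, r l ≤ 1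
  one_le : ∀ i j l, trilin T.coeff (a i) (b j) (c l) ≠ 0 → 1 ≤ M * geomMean θ (p i) (q j) (r l)

section

variable {K : Type*} [Field K] {θ : Fin 3 → ℝ}

theorem bddBelow_upperSupport (T : Tensor3 K) :
    BddBelow {v | ∃ (A : (T.I → K) ≃ₗ[K] (T.I → K)) (B : (T.J → K) ≃ₗ[K] (T.J → K))
      (C : (T.L → K) ≃ₗ[K] (T.L → K)) (S : T.I → T.J → T.L → K),
      (∀ x y z, trilin S x y z = trilin T.coeff (A x) (B y) (C z)) ∧ v = supportValue θ S} :=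
  ⟨0, by rintro _ ⟨A, B, C, S, -, rfl⟩; exact supportValue_nonneg S⟩

theorem upperSupport_nonneg (T : Tensor3 K) : 0 ≤ upperSupport θ T :=
  Real.sInf_nonneg (by rintro _ ⟨A, B, C, S, -, rfl⟩; exact supportValue_nonneg S)

theorem Certificate.upperSupport_le (hθ : θ ∈ stdSimplex ℝ (Fin 3)) {T : Tensor3 K} {M : ℝ}
    (Z : Certificate θ T M) : upperSupport θ T ≤ M := by
  have e : ∀ {X : Type} [Fintype X] (v : Module.Basis X K (X → K)) (x : X → K),
      v.equivFun.symm x = ∑ i, x i • v i := fun v x => v.equivFun_symm_apply x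
  refine (csInf_le (bddBelow_upperSupport T) ⟨Z.a.equivFun.symm, Z.b.equivFun.symm,
    Z.c.equivFun.symm, fun i j l => trilin T.coeff (Z.a i) (Z.b j) (Z.c l), fun x y z => ?_,
    rfl⟩).trans
    (supportValue_le hθ Z.nonneg Z.p_nonneg Z.q_nonneg Z.r_nonneg Z.p_sum Z.q_sum Z.r_sum Z.one_le)
  rw [e, e, e, trilin_sum_smul]

theorem exists_certificate (hθ : θ ∈ stdSimplex ℝ (Fin 3)) {T : Tensor3 K} {M : ℝ}
    (hM : upperSupport θ T < M) : Nonempty (Certificate θ T M) := by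
  classical
  obtain ⟨_, ⟨A, B, C, S, hS, rfl⟩, hlt⟩ := exists_lt_of_csInf_lt
    (by exact ⟨_, LinearEquiv.refl .., LinearEquiv.refl .., LinearEquiv.refl .., T.coeff,
      fun _ _ _ => rfl, rfl⟩) hM
  obtain ⟨p, q, r, hp, hq, hr, hp1, hq1, hr1, h⟩ := exists_weights hθ S
  refine ⟨⟨(supportValue_nonneg S).trans hlt.le, (Pi.basisFun K T.I).map A,
    (Pi.basisFun K T.J).map B, (Pi.basisFun K T.L).map C, p, q, r, hp, hq, hr, hp1, hq1, hr1,
    fun i j l hne => ?_⟩⟩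
  simp only [Module.Basis.map_apply, Pi.basisFun_apply, ← hS, trilin_single] at hne
  exact (h i j l hne).trans (mul_le_mul_of_nonneg_right hlt.le
    (geomMean_nonneg (hp i) (hq j) (hr l)))

/-- The bound of a certificate for vectors that are not in the bases: a vector is charged
the largest weight on its support. -/
theorem Certificate.one_le_of_trilin_ne_zero (hθ : θ ∈ stdSimplex ℝ (Fin 3)) {T : Tensor3 K}
    {M : ℝ} (Z : Certificate θ T M) {x : T.I → K} {y : T.J → K} {z : T.L → K} {u v w : ℝ}
    (hu : ∀ i, Z.a.coord i x ≠ 0 → Z.p i ≤ u) (hv : ∀ j, Z.b.coord j y ≠ 0 → Z.q j ≤ v)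
    (hw : ∀ l, Z.c.coord l z ≠ 0 → Z.r l ≤ w) (h : trilin T.coeff x y z ≠ 0) :
    1 ≤ M * geomMean θ u v w := by
  rw [← Z.a.sum_repr x, ← Z.b.sum_repr y, ← Z.c.sum_repr z, trilin_sum_smul] at h
  obtain ⟨i, j, l, ht, hx, hy, hz⟩ := exists_ne_zero_of_trilin_ne_zero _ h
  exact (Z.one_le i j l ht).trans (mul_le_mul_of_nonneg_left
    (geomMean_mono hθ (Z.p_nonneg i) (Z.q_nonneg j) (Z.r_nonneg l) (hu i hx) (hv j hy) (hw l hz))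
    Z.nonneg)

/-- Uniform weights in the standard bases. -/
noncomputable def Certificate.uniform (θ : Fin 3 → ℝ) (T : Tensor3 K) : Certificate θ T
    (geomMean θ (Fintype.card T.I) (Fintype.card T.J) (Fintype.card T.L)) where
  nonneg := geomMean_nonneg (by positivity) (by positivity) (by positivity)
  a := Pi.basisFun K T.I
  b := Pi.basisFun K T.J
  c := Pi.basisFun K T.L
  p _ := (Fintype.card T.I : ℝ)⁻¹
  q _ := (Fintype.card T.J : ℝ)⁻¹
  r _ := (Fintype.card T.L : ℝ)⁻¹
  p_nonneg _ := by positivity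
  q_nonneg _ := by positivity
  r_nonneg _ := by positivity
  p_sum := by simpa using mul_inv_le_one
  q_sum := by simpa using mul_inv_le_one
  r_sum := by simpa using mul_inv_le_one
  one_le i j l _ := by
    have h : ∀ {X : Type} [Fintype X], X → (Fintype.card X : ℝ) * (Fintype.card X : ℝ)⁻¹ = 1 :=
      fun {X} _ x => mul_inv_cancel₀ (by
        have := Fintype.card_pos_iff.2 ⟨x⟩
        positivity)
    rw [← geomMean_mul (by positivity) (by positivity) (by positivity) (by positivity)
      (by positivity) (by positivity), h i, h j, h l]
    simp [geomMean]

theorem upperSupport_le_geomMean_card (hθ : θ ∈ stdSimplex ℝ (Fin 3)) (T : Tensor3 K) :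
    upperSupport θ T ≤ geomMean θ (Fintype.card T.I) (Fintype.card T.J) (Fintype.card T.L) :=
  (Certificate.uniform θ T).upperSupport_le hθ

/-! ### Monotonicity -/

theorem exists_basis_weights {X κ : Type*} [Fintype X] [Fintype κ] (φ : κ → (X → K) →ₗ[K] K)
    (p : κ → ℝ) (hp : ∀ k, 0 ≤ p k) : ∃ (f : Module.Basis X K (X → K)) (p' : X → ℝ),
      (∀ x, 0 ≤ p' x) ∧ ∑ x, p' x ≤ ∑ k, p k ∧ ∀ x k, φ k (f x) ≠ 0 → p k ≤ p' x := by
  classical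
  let _ : LinearOrder X := LinearOrder.lift' (Fintype.equivFin X) (Fintype.equivFin X).injective
  obtain ⟨f, p', -, h⟩ := exists_adapted_basis (Pi.basisFun K X) φ p hp
  exact ⟨f, p', h⟩

theorem Certificate.of_restricts (hθ : θ ∈ stdSimplex ℝ (Fin 3)) {S T : Tensor3 K} {M : ℝ}
    (Z : Certificate θ T M) (h : Restricts S T) : Nonempty (Certificate θ S M) := by
  obtain ⟨A, B, C, h⟩ := h
  obtain ⟨a, p, hp, hp1, hpa⟩ :=
    exists_basis_weights (fun i => Z.a.coord i ∘ₗ A) Z.p Z.p_nonneg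
  obtain ⟨b, q, hq, hq1, hqb⟩ :=
    exists_basis_weights (fun i => Z.b.coord i ∘ₗ B) Z.q Z.q_nonneg
  obtain ⟨c, r, hr, hr1, hrc⟩ :=
    exists_basis_weights (fun i => Z.c.coord i ∘ₗ C) Z.r Z.r_nonneg
  exact ⟨⟨Z.nonneg, a, b, c, p, q, r, hp, hq, hr, hp1.trans Z.p_sum, hq1.trans Z.q_sum,
    hr1.trans Z.r_sum, fun i j l hne =>
      Z.one_le_of_trilin_ne_zero hθ (hpa i) (hqb j) (hrc l) (h _ _ _ ▸ hne)⟩⟩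

theorem upperSupport_mono (hθ : θ ∈ stdSimplex ℝ (Fin 3)) {S T : Tensor3 K} (h : Restricts S T) :
    upperSupport θ S ≤ upperSupport θ T := by
  refine le_of_forall_gt_imp_ge_of_dense fun M hM => ?_
  obtain ⟨Z⟩ := exists_certificate hθ hM
  obtain ⟨Z'⟩ := Z.of_restricts hθ h
  exact Z'.upperSupport_le hθ

/-! ### Kronecker products -/

/-- Products of linearly independent families of functions in separate variables are linearly
independent. -/
theorem linearIndependent_mul {α β X Y Z : Type*} [Finite α] [Finite β] {f : α → X → K}
    {g : β → Y → K} (hf : LinearIndependent K f) (hg : LinearIndependent K g) {F : α × β → Z → K}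
    (e : X → Y → Z) (h : ∀ a b x y, F (a, b) (e x y) = f a x * g b y) :
    LinearIndependent K F := by
  cases nonempty_fintype α
  cases nonempty_fintype β
  rw [Fintype.linearIndependent_iff] at hf hg ⊢
  rintro w hw ⟨a, b⟩
  refine hg (fun b => w (a, b)) (funext fun y => ?_) b
  have h1 := hf (fun a => ∑ b, w (a, b) * g b y) (funext fun x => ?_) a
  · simpa using h1
  · have h2 := congrFun hw (e x y)
    simp only [Finset.sum_apply, Pi.smul_apply, smul_eq_mul, Fintype.sum_prod_type, h,
      Pi.zero_apply] at h2 ⊢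
    rw [← h2]
    refine Finset.sum_congr rfl fun a _ => ?_
    rw [Finset.sum_mul]
    exact Finset.sum_congr rfl fun b _ => by ring

theorem exists_basis_mul {X Y : Type*} [Fintype X] [Fintype Y] (a : Module.Basis X K (X → K))
    (b : Module.Basis Y K (Y → K)) : ∃ f : Module.Basis (X × Y) K (X × Y → K),
      ∀ x, f x = fun z => a x.1 z.1 * b x.2 z.2 := by
  have h : LinearIndependent K fun (x : X × Y) (z : X × Y) => a x.1 z.1 * b x.2 z.2 :=
    linearIndependent_mul a.linearIndependent b.linearIndependent Prod.mk fun _ _ _ _ => rfl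
  exact ⟨Module.Basis.mk h (h.span_eq_top_of_card_eq_finrank' (by simp)).ge, fun x => by simp⟩

theorem trilin_kron (S T : Tensor3 K) (x : S.I → K) (y : S.J → K) (z : S.L → K) (x' : T.I → K)
    (y' : T.J → K) (z' : T.L → K) :
    trilin (S.kron T).coeff (fun u => x u.1 * x' u.2) (fun u => y u.1 * y' u.2)
      (fun u => z u.1 * z' u.2) = trilin S.coeff x y z * trilin T.coeff x' y' z' := by
  have e : ∀ {α β : Type} [Fintype α] [Fintype β] (f : α → K) (g : β → K),
      ∑ x : α × β, f x.1 * g x.2 = (∑ a, f a) * ∑ b, g b := by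
    intro α β _ _ f g
    rw [Fintype.sum_mul_sum, Fintype.sum_prod_type]
  simp only [trilin, kron]
  rw [← e]
  refine Finset.sum_congr rfl fun i' _ => ?_
  rw [← e]
  refine Finset.sum_congr rfl fun j' _ => ?_
  rw [← e]
  exact Finset.sum_congr rfl fun l' _ => by ring

theorem sum_mul_le_one {X Y : Type*} [Fintype X] [Fintype Y] {p : X → ℝ} {p' : Y → ℝ}
    (hp : ∑ x, p x ≤ 1) (hp0' : ∀ y, 0 ≤ p' y) (hp' : ∑ y, p' y ≤ 1) :
    ∑ x : X × Y, p x.1 * p' x.2 ≤ 1 := by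
  rw [Fintype.sum_prod_type, ← Fintype.sum_mul_sum]
  exact mul_le_one₀ hp (Finset.sum_nonneg fun y _ => hp0' y) hp'

theorem Certificate.kron {S T : Tensor3 K} {M N : ℝ} (Z : Certificate θ S M)
    (W : Certificate θ T N) : Nonempty (Certificate θ (S.kron T) (M * N)) := by
  obtain ⟨a, ha⟩ : ∃ f : Module.Basis (S.kron T).I K ((S.kron T).I → K),
      ∀ x, f x = fun z => Z.a x.1 z.1 * W.a x.2 z.2 := exists_basis_mul Z.a W.a
  obtain ⟨b, hb⟩ : ∃ f : Module.Basis (S.kron T).J K ((S.kron T).J → K),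
      ∀ x, f x = fun z => Z.b x.1 z.1 * W.b x.2 z.2 := exists_basis_mul Z.b W.b
  obtain ⟨c, hc⟩ : ∃ f : Module.Basis (S.kron T).L K ((S.kron T).L → K),
      ∀ x, f x = fun z => Z.c x.1 z.1 * W.c x.2 z.2 := exists_basis_mul Z.c W.c
  refine ⟨⟨mul_nonneg Z.nonneg W.nonneg, a, b, c, fun x => Z.p x.1 * W.p x.2,
    fun x => Z.q x.1 * W.q x.2, fun x => Z.r x.1 * W.r x.2,
    fun x => mul_nonneg (Z.p_nonneg _) (W.p_nonneg _),
    fun x => mul_nonneg (Z.q_nonneg _) (W.q_nonneg _),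
    fun x => mul_nonneg (Z.r_nonneg _) (W.r_nonneg _),
    sum_mul_le_one Z.p_sum W.p_nonneg W.p_sum, sum_mul_le_one Z.q_sum W.q_nonneg W.q_sum,
    sum_mul_le_one Z.r_sum W.r_nonneg W.r_sum, fun i j l hne => ?_⟩⟩
  rw [ha, hb, hc, trilin_kron] at hne
  rw [geomMean_mul (Z.p_nonneg _) (Z.q_nonneg _) (Z.r_nonneg _) (W.p_nonneg _) (W.q_nonneg _)
    (W.r_nonneg _), mul_mul_mul_comm]
  exact one_le_mul_of_one_le_of_one_le (Z.one_le _ _ _ (left_ne_zero_of_mul hne))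
    (W.one_le _ _ _ (right_ne_zero_of_mul hne))

theorem upperSupport_kron_le (hθ : θ ∈ stdSimplex ℝ (Fin 3)) (S T : Tensor3 K) :
    upperSupport θ (S.kron T) ≤ upperSupport θ S * upperSupport θ T := by
  have h : ∀ ε ∈ Set.Ioi (0 : ℝ), upperSupport θ (S.kron T) ≤
      (upperSupport θ S + ε) * (upperSupport θ T + ε) := by
    intro ε hε
    obtain ⟨Z⟩ := exists_certificate hθ (lt_add_of_pos_right (upperSupport θ S) hε)
    obtain ⟨W⟩ := exists_certificate hθ (lt_add_of_pos_right (upperSupport θ T) hε)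
    obtain ⟨V⟩ := Z.kron W
    exact V.upperSupport_le hθ
  have hc : Continuous fun ε : ℝ => (upperSupport θ S + ε) * (upperSupport θ T + ε) := by fun_prop
  have hlim : Tendsto (fun ε : ℝ => (upperSupport θ S + ε) * (upperSupport θ T + ε)) (𝓝[>] 0)
      (𝓝 (upperSupport θ S * upperSupport θ T)) :=
    (hc.tendsto' 0 _ (by simp)).mono_left nhdsWithin_le_nhds
  refine ge_of_tendsto hlim ?_
  filter_upwards [self_mem_nhdsWithin] with ε hε using h ε hε

/-! ### Direct sums -/

theorem trilin_dsum (S T : Tensor3 K) (x : S.I → K) (y : S.J → K) (z : S.L → K) (x' : T.I → K)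
    (y' : T.J → K) (z' : T.L → K) :
    trilin (S.dsum T).coeff (Sum.elim x x') (Sum.elim y y') (Sum.elim z z') =
      trilin S.coeff x y z + trilin T.coeff x' y' z' := by
  change ∑ i : S.I ⊕ T.I, ∑ j : S.J ⊕ T.J, ∑ l : S.L ⊕ T.L,
    (S.dsum T).coeff i j l * Sum.elim x x' i * Sum.elim y y' j * Sum.elim z z' l = _
  simp [trilin, dsum, Fintype.sum_sum_type]

theorem exists_basis_sum {X Y : Type*} [Fintype X] [Fintype Y] (a : Module.Basis X K (X → K))
    (b : Module.Basis Y K (Y → K)) : ∃ f : Module.Basis (X ⊕ Y) K (X ⊕ Y → K),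
      (∀ x, f (.inl x) = Sum.elim (a x) 0) ∧ ∀ y, f (.inr y) = Sum.elim (0 : X → K) (b y) := by
  refine ⟨(a.prod b).map (LinearEquiv.sumArrowLequivProdArrow X Y K K).symm, fun x => ?_,
    fun y => ?_⟩ <;> ext (z | z) <;> simp

theorem trilin_zero_left {I J L : Type*} [Fintype I] [Fintype J] [Fintype L] (t : I → J → L → K)
    (y : J → K) (z : L → K) : trilin t 0 y z = 0 := by simp [trilin]

theorem trilin_zero_mid {I J L : Type*} [Fintype I] [Fintype J] [Fintype L] (t : I → J → L → K)
    (x : I → K) (z : L → K) : trilin t x 0 z = 0 := by simp [trilin]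

theorem trilin_zero_right {I J L : Type*} [Fintype I] [Fintype J] [Fintype L] (t : I → J → L → K)
    (x : I → K) (y : J → K) : trilin t x y 0 = 0 := by simp [trilin]

theorem geomMean_const_mul (hθ : θ ∈ stdSimplex ℝ (Fin 3)) {c x y z : ℝ} (hc : 0 ≤ c)
    (hx : 0 ≤ x) (hy : 0 ≤ y) (hz : 0 ≤ z) :
    geomMean θ (c * x) (c * y) (c * z) = c * geomMean θ x y z := by
  rw [geomMean_mul hc hc hc hx hy hz, geomMean_self hθ hc]

theorem Certificate.dsum (hθ : θ ∈ stdSimplex ℝ (Fin 3)) {S T : Tensor3 K} {M N : ℝ}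
    (Z : Certificate θ S M) (W : Certificate θ T N) :
    Nonempty (Certificate θ (S.dsum T) (M + N)) := by
  obtain ⟨a, ha, ha'⟩ : ∃ f : Module.Basis (S.dsum T).I K ((S.dsum T).I → K),
      (∀ x, f (.inl x) = Sum.elim (Z.a x) 0) ∧ ∀ y, f (.inr y) = Sum.elim (0 : S.I → K) (W.a y) :=
    exists_basis_sum Z.a W.a
  obtain ⟨b, hb, hb'⟩ : ∃ f : Module.Basis (S.dsum T).J K ((S.dsum T).J → K),
      (∀ x, f (.inl x) = Sum.elim (Z.b x) 0) ∧ ∀ y, f (.inr y) = Sum.elim (0 : S.J → K) (W.b y) :=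
    exists_basis_sum Z.b W.b
  obtain ⟨c, hc, hc'⟩ : ∃ f : Module.Basis (S.dsum T).L K ((S.dsum T).L → K),
      (∀ x, f (.inl x) = Sum.elim (Z.c x) 0) ∧ ∀ y, f (.inr y) = Sum.elim (0 : S.L → K) (W.c y) :=
    exists_basis_sum Z.c W.c
  have hM := Z.nonneg
  have hN := W.nonneg
  have hZ : 0 ≤ M / (M + N) := by positivity
  have hW : 0 ≤ N / (M + N) := by positivity
  have hnn : ∀ {X Y : Type} {p : X → ℝ} {p' : Y → ℝ}, (∀ x, 0 ≤ p x) → (∀ y, 0 ≤ p' y) →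
      ∀ x, 0 ≤ Sum.elim (fun x => M / (M + N) * p x) (fun y => N / (M + N) * p' y) x := by
    rintro X Y p p' hp hp' (x | y)
    · exact mul_nonneg hZ (hp x)
    · exact mul_nonneg hW (hp' y)
  have hsum : ∀ {X Y : Type} [Fintype X] [Fintype Y] {p : X → ℝ} {p' : Y → ℝ},
      ∑ x, p x ≤ 1 → ∑ y, p' y ≤ 1 → ∑ x, Sum.elim (fun x => M / (M + N) * p x)
        (fun y => N / (M + N) * p' y) x ≤ 1 := by
    intro X Y _ _ p p' hp hp'
    simp only [Fintype.sum_sum_type, Sum.elim_inl, Sum.elim_inr, ← Finset.mul_sum]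
    calc _ ≤ M / (M + N) * 1 + N / (M + N) * 1 := by gcongr
      _ = (M + N) / (M + N) := by ring
      _ ≤ 1 := div_self_le_one _
  -- a certificate with bound `0` can only exist for a zero tensor
  have hpos : ∀ {u g : ℝ}, 0 ≤ u → 1 ≤ u * g → 0 < u := fun {u g} hu h =>
    hu.lt_of_ne fun h0 => by rw [← h0, zero_mul] at h; linarith
  refine ⟨⟨add_nonneg hM hN, a, b, c, _, _, _, hnn Z.p_nonneg W.p_nonneg,
    hnn Z.q_nonneg W.q_nonneg, hnn Z.r_nonneg W.r_nonneg, hsum Z.p_sum W.p_sum,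
    hsum Z.q_sum W.q_sum, hsum Z.r_sum W.r_sum, ?_⟩⟩
  rintro (i | i) (j | j) (l | l) hne <;>
  simp only [ha, ha', hb, hb', hc, hc', trilin_dsum, trilin_zero_left, trilin_zero_mid,
    trilin_zero_right, add_zero, zero_add, ne_eq, not_true_eq_false] at hne
  · have h := Z.one_le i j l hne
    have := hpos hM h
    simp only [Sum.elim_inl]
    rw [geomMean_const_mul hθ hZ (Z.p_nonneg i) (Z.q_nonneg j) (Z.r_nonneg l), ← mul_assoc,
      mul_div_cancel₀ _ (by positivity)]
    exact h
  · have h := W.one_le i j l hne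
    have := hpos hN h
    simp only [Sum.elim_inr]
    rw [geomMean_const_mul hθ hW (W.p_nonneg i) (W.q_nonneg j) (W.r_nonneg l), ← mul_assoc,
      mul_div_cancel₀ _ (by positivity)]
    exact h

/-- Weights on a direct sum split: the first summand is taken as a subspace, the second one as
a quotient, with representatives whose components in the first summand are `g`. -/
theorem exists_basis_split {X Y κ : Type*} [Fintype X] [Fintype Y] [Fintype κ]
    (φ : κ → (X ⊕ Y → K) →ₗ[K] K) (p : κ → ℝ) (hp : ∀ k, 0 ≤ p k) :
    ∃ (a : Module.Basis X K (X → K)) (b : Module.Basis Y K (Y → K)) (g : Y → X → K)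
      (p₁ : X → ℝ) (p₂ : Y → ℝ), (∀ x, 0 ≤ p₁ x) ∧ (∀ y, 0 ≤ p₂ y) ∧
      ∑ x, p₁ x + ∑ y, p₂ y ≤ ∑ k, p k ∧ (∀ x k, φ k (Sum.elim (a x) 0) ≠ 0 → p k ≤ p₁ x) ∧
      ∀ y k, φ k (Sum.elim (g y) (b y)) ≠ 0 → p k ≤ p₂ y := by
  classical
  let _ : LinearOrder X := LinearOrder.lift' (Fintype.equivFin X) (Fintype.equivFin X).injective
  let _ : LinearOrder Y := LinearOrder.lift' (Fintype.equivFin Y) (Fintype.equivFin Y).injective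
  let _ : LinearOrder (X ⊕ Y) :=
    LinearOrder.lift' (toLex : X ⊕ Y → X ⊕ₗ Y) toLex.injective
  obtain ⟨f, p', h1, h2, h3, h4⟩ := exists_adapted_basis (Pi.basisFun K (X ⊕ Y)) φ p hp
  -- the vectors with index in `X` lie in the first summand, since `X` precedes `Y`
  have hinl : ∀ x y, f (.inl x) (.inr y) = 0 := by
    intro x y
    have h := (Submodule.span_le (p := LinearMap.ker
      (LinearMap.proj (R := K) (φ := fun _ : X ⊕ Y => K) (.inr y)))).2 (by
        rintro _ ⟨u | u, hu, rfl⟩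
        · simp
        · exact absurd hu Sum.Lex.not_inr_lt_inl) (h1 (.inl x))
    simpa using h
  have hX : LinearIndependent K fun x => f (.inl x) ∘ Sum.inl := by
    have h := f.linearIndependent.comp _ (Sum.inl_injective (α := X) (β := Y))
    rw [Fintype.linearIndependent_iff] at h ⊢
    intro w hw
    refine h w (funext fun u => ?_)
    rcases u with u | u
    · simpa using congrFun hw u
    · simp [hinl]
  have hY : ⊤ ≤ Submodule.span K (Set.range fun y => f (.inr y) ∘ Sum.inr) := by
    have h5 : Submodule.map (LinearMap.funLeft K K (Sum.inr : Y → X ⊕ Y))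
        (Submodule.span K (Set.range f)) ≤
          Submodule.span K (Set.range fun y => f (.inr y) ∘ Sum.inr) := by
      rw [Submodule.map_span, Submodule.span_le]
      rintro _ ⟨_, ⟨x | y, rfl⟩, rfl⟩
      · have h0 : LinearMap.funLeft K K (Sum.inr : Y → X ⊕ Y) (f (.inl x)) = 0 :=
          funext fun y => hinl x y
        rw [h0]
        exact Submodule.zero_mem _
      · exact Submodule.subset_span ⟨y, rfl⟩
    rwa [f.span_eq, Submodule.map_top, LinearMap.range_eq_top.2
      (LinearMap.funLeft_surjective_of_injective _ _ _ Sum.inr_injective)] at h5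
  refine ⟨Module.Basis.mk hX (hX.span_eq_top_of_card_eq_finrank' (by simp)).ge,
    basisOfTopLeSpanOfCardEqFinrank _ hY (by simp), fun y => f (.inr y) ∘ Sum.inl,
    fun x => p' (.inl x), fun y => p' (.inr y), fun x => h2 _, fun y => h2 _,
    by rwa [Fintype.sum_sum_type] at h3, fun x k hk => h4 _ _ ?_, fun y k hk => h4 _ _ ?_⟩
  · convert hk
    ext (u | u)
    · simp
    · simp [hinl]
  · convert hk
    ext (u | u) <;> simp

theorem exists_basis_split' {X Y κ : Type*} [Fintype X] [Fintype Y] [Fintype κ]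
    (φ : κ → (X ⊕ Y → K) →ₗ[K] K) (p : κ → ℝ) (hp : ∀ k, 0 ≤ p k) :
    ∃ (a : Module.Basis X K (X → K)) (b : Module.Basis Y K (Y → K)) (g : X → Y → K)
      (p₁ : X → ℝ) (p₂ : Y → ℝ), (∀ x, 0 ≤ p₁ x) ∧ (∀ y, 0 ≤ p₂ y) ∧
      ∑ x, p₁ x + ∑ y, p₂ y ≤ ∑ k, p k ∧ (∀ x k, φ k (Sum.elim (a x) (g x)) ≠ 0 → p k ≤ p₁ x) ∧
      ∀ y k, φ k (Sum.elim 0 (b y)) ≠ 0 → p k ≤ p₂ y := by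
  obtain ⟨b, a, g, p₂, p₁, h2, h3, h4, h5, h6⟩ := exists_basis_split
    (fun k => φ k ∘ₗ LinearMap.funLeft K K (Sum.swap : X ⊕ Y → Y ⊕ X)) p hp
  have hswap : ∀ (u : Y → K) (v : X → K),
      LinearMap.funLeft K K (Sum.swap : X ⊕ Y → Y ⊕ X) (Sum.elim u v) = Sum.elim v u :=
    fun u v => by ext (w | w) <;> simp [LinearMap.funLeft_apply]
  simp only [LinearMap.coe_comp, Function.comp_apply, hswap] at h5 h6
  exact ⟨a, b, g, p₁, p₂, h3, h2, by rwa [add_comm], h6, h5⟩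

/-- Normalizing the weights of a certificate. -/
theorem Certificate.of_weights (hθ : θ ∈ stdSimplex ℝ (Fin 3)) {T : Tensor3 K} {M : ℝ}
    (hM : 0 ≤ M) (a : Module.Basis T.I K (T.I → K)) (b : Module.Basis T.J K (T.J → K))
    (c : Module.Basis T.L K (T.L → K)) {p : T.I → ℝ} {q : T.J → ℝ} {r : T.L → ℝ}
    (hp : ∀ i, 0 ≤ p i) (hq : ∀ j, 0 ≤ q j) (hr : ∀ l, 0 ≤ r l)
    (h : ∀ i j l, trilin T.coeff (a i) (b j) (c l) ≠ 0 → 1 ≤ M * geomMean θ (p i) (q j) (r l)) :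
    upperSupport θ T ≤ M * geomMean θ (∑ i, p i) (∑ j, q j) (∑ l, r l) := by
  have hp' : 0 ≤ ∑ i, p i := Finset.sum_nonneg fun i _ => hp i
  have hq' : 0 ≤ ∑ i, q i := Finset.sum_nonneg fun i _ => hq i
  have hr' : 0 ≤ ∑ i, r i := Finset.sum_nonneg fun i _ => hr i
  have e : ∀ {X : Type} [Fintype X] {u : X → ℝ}, (∀ x, 0 ≤ u x) →
      ∀ x, (∑ x, u x) * (u x / ∑ x, u x) = u x := by
    intro X _ u hu x
    by_cases h0 : ∑ x, u x = 0
    · rw [h0, zero_mul, (Finset.sum_eq_zero_iff_of_nonneg fun x _ => hu x).1 h0 x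
        (Finset.mem_univ x)]
    · exact mul_div_cancel₀ _ h0
  refine (Certificate.mk (mul_nonneg hM (geomMean_nonneg hp' hq' hr')) a b c
    (fun i => p i / ∑ i, p i) (fun j => q j / ∑ j, q j) (fun l => r l / ∑ l, r l)
    (fun i => div_nonneg (hp i) hp') (fun i => div_nonneg (hq i) hq')
    (fun i => div_nonneg (hr i) hr') ?_ ?_ ?_ fun i j l hne => ?_).upperSupport_le hθ
  · rw [← Finset.sum_div]; exact div_self_le_one _
  · rw [← Finset.sum_div]; exact div_self_le_one _
  · rw [← Finset.sum_div]; exact div_self_le_one _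
  · rw [mul_assoc, ← geomMean_mul hp' hq' hr' (div_nonneg (hp i) hp') (div_nonneg (hq j) hq')
      (div_nonneg (hr l) hr'), e hp, e hq, e hr]
    exact h i j l hne

/-- Superadditivity. The summand `T` is a quotient in the first and third factor, but a subspace in
the second one, which suffices to keep `S` from interfering, and vice versa. -/
theorem Certificate.add_le (hθ : θ ∈ stdSimplex ℝ (Fin 3)) {S T : Tensor3 K} {M : ℝ}
    (Z : Certificate θ (S.dsum T) M) : upperSupport θ S + upperSupport θ T ≤ M := by
  obtain ⟨a₁, a₂, f, p₁, p₂, hp₁, hp₂, hp, hpa, hpf⟩ :=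
    exists_basis_split (fun i => Z.a.coord i) Z.p Z.p_nonneg
  obtain ⟨b₁, b₂, g, q₁, q₂, hq₁, hq₂, hq, hqg, hqb⟩ :=
    exists_basis_split' (fun i => Z.b.coord i) Z.q Z.q_nonneg
  obtain ⟨c₁, c₂, h, r₁, r₂, hr₁, hr₂, hr, hrc, hrh⟩ :=
    exists_basis_split (fun i => Z.c.coord i) Z.r Z.r_nonneg
  have hS := Certificate.of_weights hθ (T := S) Z.nonneg a₁ b₁ c₁ hp₁ hq₁ hr₁ fun i j l hne => by
    refine Z.one_le_of_trilin_ne_zero hθ (hpa i) (hqg j) (hrc l) ?_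
    rwa [trilin_dsum, trilin_zero_left, add_zero]
  have hT := Certificate.of_weights hθ (T := T) Z.nonneg a₂ b₂ c₂ hp₂ hq₂ hr₂ fun i j l hne => by
    refine Z.one_le_of_trilin_ne_zero hθ (hpf i) (hqb j) (hrh l) ?_
    rwa [trilin_dsum, trilin_zero_mid, zero_add]
  have nn : ∀ {X : Type} [Fintype X] {u : X → ℝ}, (∀ x, 0 ≤ u x) → 0 ≤ ∑ x, u x :=
    fun hu => Finset.sum_nonneg fun x _ => hu x
  have g₁ := geomMean_le hθ (nn hp₁) (nn hq₁) (nn hr₁)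
  have g₂ := geomMean_le hθ (nn hp₂) (nn hq₂) (nn hr₂)
  have k₀ := mul_le_mul_of_nonneg_left (hp.trans Z.p_sum) (hθ.1 0)
  have k₁ := mul_le_mul_of_nonneg_left (hq.trans Z.q_sum) (hθ.1 1)
  have k₂ := mul_le_mul_of_nonneg_left (hr.trans Z.r_sum) (hθ.1 2)
  have hle : geomMean θ (∑ i, p₁ i) (∑ j, q₁ j) (∑ l, r₁ l) +
      geomMean θ (∑ i, p₂ i) (∑ j, q₂ j) (∑ l, r₂ l) ≤ 1 := by
    linarith [sum_stdSimplex_three hθ]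
  have := mul_le_mul_of_nonneg_left hle Z.nonneg
  linarith

theorem upperSupport_dsum (hθ : θ ∈ stdSimplex ℝ (Fin 3)) (S T : Tensor3 K) :
    upperSupport θ (S.dsum T) = upperSupport θ S + upperSupport θ T := by
  refine le_antisymm (le_of_forall_pos_le_add fun ε hε => ?_)
    (le_of_forall_gt_imp_ge_of_dense fun M hM => ?_)
  · obtain ⟨Z⟩ := exists_certificate hθ (lt_add_of_pos_right (upperSupport θ S) (half_pos hε))
    obtain ⟨W⟩ := exists_certificate hθ (lt_add_of_pos_right (upperSupport θ T) (half_pos hε))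
    obtain ⟨V⟩ := Z.dsum hθ W
    linarith [V.upperSupport_le hθ]
  · obtain ⟨Z⟩ := exists_certificate hθ hM
    exact Z.add_le hθ

end

/-! ### Matrix multiplication tensors: the value of the upper support functional -/

section

variable {K : Type*} [Field K] {θ : Fin 3 → ℝ}

/-- In a basis that is unitriangular with respect to the standard basis, the coordinates of `f x`
are `1` at `x` and `0` at all `y` that are not `≤ x`. -/
theorem apply_of_sub_mem_span {X : Type*} [Fintype X] [LinearOrder X]
    {f : X → X → K} (h : ∀ x, f x - Pi.basisFun K X x ∈
      Submodule.span K (Pi.basisFun K X '' Set.Iio x)) (x : X) :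
    f x x = 1 ∧ ∀ y, f x y ≠ 0 → y ≤ x := by
  have key : ∀ y, x ≤ y → f x y = Pi.basisFun K X x y := by
    intro y hy
    have h1 := (Submodule.span_le (p := LinearMap.ker
      (LinearMap.proj (R := K) (φ := fun _ : X => K) y))).2 (by
        rintro _ ⟨u, hu, rfl⟩
        have hne : y ≠ u := (lt_of_lt_of_le hu hy).ne'
        simp [hne]) (h x)
    simpa [sub_eq_zero] using h1
  refine ⟨by simpa using key x le_rfl, fun y hy => ?_⟩
  by_contra! hlt
  rw [key y hlt.le] at hy
  simp [hlt.ne'] at hy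

/-- If the support of `T` is an antichain for some linear orders on the three index sets, then a
certificate in any bases gives weights for the standard bases: with bases adapted both to these
orders and to the weights, the coefficients on the support do not change. -/
theorem Certificate.exists_weights_of_antichain (hθ : θ ∈ stdSimplex ℝ (Fin 3)) {T : Tensor3 K}
    {M : ℝ} (Z : Certificate θ T M) {X Y W : Type*} [LinearOrder X] [LinearOrder Y] [LinearOrder W]
    {α : T.I → X} {β : T.J → Y} {γ : T.L → W} (hα : α.Injective) (hβ : β.Injective)
    (hγ : γ.Injective)
    (h : ∀ i j l i' j' l', T.coeff i j l ≠ 0 → T.coeff i' j' l' ≠ 0 → α i' ≤ α i → β j' ≤ β j →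
      γ l' ≤ γ l → i' = i ∧ j' = j ∧ l' = l) :
    ∃ (p : T.I → ℝ) (q : T.J → ℝ) (r : T.L → ℝ), (∀ i, 0 ≤ p i) ∧ (∀ j, 0 ≤ q j) ∧
      (∀ l, 0 ≤ r l) ∧ ∑ i, p i ≤ 1 ∧ ∑ j, q j ≤ 1 ∧ ∑ l, r l ≤ 1 ∧
      ∀ i j l, T.coeff i j l ≠ 0 → 1 ≤ M * geomMean θ (p i) (q j) (r l) := by
  let _ : LinearOrder T.I := LinearOrder.lift' α hα
  let _ : LinearOrder T.J := LinearOrder.lift' β hβ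
  let _ : LinearOrder T.L := LinearOrder.lift' γ hγ
  obtain ⟨a, p, ha, hp, hp1, hpa⟩ :=
    exists_adapted_basis (Pi.basisFun K T.I) (fun i => Z.a.coord i) Z.p Z.p_nonneg
  obtain ⟨b, q, hb, hq, hq1, hqb⟩ :=
    exists_adapted_basis (Pi.basisFun K T.J) (fun i => Z.b.coord i) Z.q Z.q_nonneg
  obtain ⟨c, r, hc, hr, hr1, hrc⟩ :=
    exists_adapted_basis (Pi.basisFun K T.L) (fun i => Z.c.coord i) Z.r Z.r_nonneg
  refine ⟨p, q, r, hp, hq, hr, hp1.trans Z.p_sum, hq1.trans Z.q_sum, hr1.trans Z.r_sum,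
    fun i j l hne => Z.one_le_of_trilin_ne_zero hθ (hpa i) (hqb j) (hrc l) ?_⟩
  obtain ⟨ha1, ha⟩ := apply_of_sub_mem_span ha i
  obtain ⟨hb1, hb⟩ := apply_of_sub_mem_span hb j
  obtain ⟨hc1, hc⟩ := apply_of_sub_mem_span hc l
  have hzero : ∀ i' j' l', ¬ (i' = i ∧ j' = j ∧ l' = l) →
      T.coeff i' j' l' * a i i' * b j j' * c l l' = 0 := by
    intro i' j' l' hn
    by_contra h0
    have h1 := left_ne_zero_of_mul h0
    have h2 := left_ne_zero_of_mul h1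
    exact hn (h i j l i' j' l' hne (left_ne_zero_of_mul h2) (ha i' (right_ne_zero_of_mul h2))
      (hb j' (right_ne_zero_of_mul h1)) (hc l' (right_ne_zero_of_mul h0)))
  rw [trilin, Finset.sum_eq_single i, Finset.sum_eq_single j, Finset.sum_eq_single l]
  · simpa [ha1, hb1, hc1] using hne
  · exact fun l' _ hl => hzero _ _ _ fun hh => hl hh.2.2
  · simp
  · exact fun j' _ hj => Finset.sum_eq_zero fun l' _ => hzero _ _ _ fun hh => hj hh.2.1
  · simp
  · exact fun i' _ hi => Finset.sum_eq_zero fun j' _ => Finset.sum_eq_zero fun l' _ =>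
      hzero _ _ _ fun hh => hi hh.1
  · simp

theorem matMul_coeff_ne_zero {a b c : ℕ} {x : Fin a × Fin b} {y : Fin b × Fin c}
    {z : Fin c × Fin a} :
    (matMul K a b c).coeff x y z ≠ 0 ↔ x.2 = y.1 ∧ y.2 = z.1 ∧ z.2 = x.1 := by
  simp [matMul]

theorem Certificate.exists_weights_matMul (hθ : θ ∈ stdSimplex ℝ (Fin 3)) {a b c : ℕ} {M : ℝ}
    (Z : Certificate θ (matMul K a b c) M) :
    ∃ (p : Fin a × Fin b → ℝ) (q : Fin b × Fin c → ℝ) (r : Fin c × Fin a → ℝ), (∀ i, 0 ≤ p i) ∧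
      (∀ j, 0 ≤ q j) ∧ (∀ l, 0 ≤ r l) ∧ ∑ i, p i ≤ 1 ∧ ∑ j, q j ≤ 1 ∧ ∑ l, r l ≤ 1 ∧
      ∀ i j k, 1 ≤ M * geomMean θ (p (i, j)) (q (j, k)) (r (k, i)) := by
  -- lexicographic orders in which `k` dominates `j` and `j` dominates `i`, and in which every index
  -- is reversed in one of its two occurrences
  obtain ⟨p, q, r, hp, hq, hr, hp1, hq1, hr1, h⟩ := Z.exists_weights_of_antichain hθ
    (α := fun x : Fin a × Fin b => toLex (OrderDual.toDual x.2, x.1))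
    (β := fun y : Fin b × Fin c => toLex (OrderDual.toDual y.2, y.1))
    (γ := fun z : Fin c × Fin a => toLex (z.1, OrderDual.toDual z.2))
    (fun x y h => by
      simp only [EmbeddingLike.apply_eq_iff_eq, Prod.mk.injEq] at h
      exact Prod.ext h.2 h.1)
    (fun x y h => by
      simp only [EmbeddingLike.apply_eq_iff_eq, Prod.mk.injEq] at h
      exact Prod.ext h.2 h.1)
    (fun x y h => by
      simp only [EmbeddingLike.apply_eq_iff_eq, Prod.mk.injEq] at h
      exact Prod.ext h.1 h.2)
    (by
      rintro ⟨i, j⟩ ⟨j₁, k⟩ ⟨k₁, i₁⟩ ⟨i', j'⟩ ⟨j₁', k'⟩ ⟨k₁', i₁'⟩ h h' hx hy hz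
      obtain ⟨h1, h2, h3⟩ := matMul_coeff_ne_zero.1 h
      obtain ⟨h1', h2', h3'⟩ := matMul_coeff_ne_zero.1 h'
      dsimp only at h1 h2 h3 h1' h2' h3'
      subst h1 h2 h3 h1' h2' h3'
      simp only [Prod.Lex.toLex_le_toLex, OrderDual.toDual_lt_toDual, OrderDual.toDual_le_toDual,
        EmbeddingLike.apply_eq_iff_eq] at hx hy hz
      suffices hs : i₁' = i₁ ∧ j' = j ∧ k' = k by
        obtain ⟨rfl, rfl, rfl⟩ := hs
        exact ⟨rfl, rfl, rfl⟩
      omega)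
  exact ⟨p, q, r, hp, hq, hr, hp1, hq1, hr1, fun i j k =>
    h (i, j) (j, k) (k, i) (matMul_coeff_ne_zero.2 ⟨rfl, rfl, rfl⟩)⟩

theorem Certificate.geomMean_le_of_matMul (hθ : θ ∈ stdSimplex ℝ (Fin 3)) {a b c : ℕ}
    (ha : 0 < a) (hb : 0 < b) (hc : 0 < c) {M : ℝ} (Z : Certificate θ (matMul K a b c) M) :
    geomMean θ (a * b) (b * c) (c * a) ≤ M := by
  obtain ⟨p, q, r, hp, hq, hr, hp1, hq1, hr1, h⟩ := Z.exists_weights_matMul hθ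
  have hM := Z.nonneg
  set D := geomMean θ (a * b) (b * c) (c * a) with hD
  have hD0 : 0 ≤ D := geomMean_nonneg (by positivity) (by positivity) (by positivity)
  have h1 : ∀ i j k, D ≤ M * (θ 0 * (a * b * p (i, j)) + θ 1 * (b * c * q (j, k)) +
      θ 2 * (c * a * r (k, i))) := by
    intro i j k
    have h2 := geomMean_le hθ (x := a * b * p (i, j)) (y := b * c * q (j, k))
      (z := c * a * r (k, i))
      (mul_nonneg (by positivity) (hp _)) (mul_nonneg (by positivity) (hq _))
      (mul_nonneg (by positivity) (hr _))
    rw [geomMean_mul (by positivity) (by positivity) (by positivity) (hp _) (hq _) (hr _)] at h2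
    have h3 := mul_le_mul_of_nonneg_left (h i j k) hD0
    have h4 := mul_le_mul_of_nonneg_left h2 hM
    rw [← hD] at h4
    linarith
  -- average over all `i`, `j`, `k`
  have h2 := Finset.sum_le_sum fun i (_ : i ∈ Finset.univ) => Finset.sum_le_sum
    fun j (_ : j ∈ Finset.univ) => Finset.sum_le_sum fun k (_ : k ∈ Finset.univ) => h1 i j k
  simp only [← Finset.mul_sum, Finset.sum_add_distrib, Finset.sum_const, Finset.card_univ,
    Fintype.card_fin, nsmul_eq_mul] at h2
  have e1 : ∑ i, ∑ j, p (i, j) ≤ 1 := by rwa [Fintype.sum_prod_type] at hp1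
  have e2 : ∑ j, ∑ k, q (j, k) ≤ 1 := by rwa [Fintype.sum_prod_type] at hq1
  have e3 : ∑ i, ∑ k, r (k, i) ≤ 1 := by
    rw [Fintype.sum_prod_type, Finset.sum_comm] at hr1; exact hr1
  have hθ' := hθ.1
  have g1 := mul_le_mul_of_nonneg_left e1 (mul_nonneg (hθ' 0) (by positivity : (0 : ℝ) ≤ a * b * c))
  have g2 := mul_le_mul_of_nonneg_left e2 (mul_nonneg (hθ' 1) (by positivity : (0 : ℝ) ≤ a * b * c))
  have g3 := mul_le_mul_of_nonneg_left e3 (mul_nonneg (hθ' 2) (by positivity : (0 : ℝ) ≤ a * b * c))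
  have hpos : (0 : ℝ) < a * b * c := by positivity
  have g4 : M * (θ 0 * (a * b * (c * ∑ i, ∑ j, p (i, j))) +
      θ 1 * (b * c * (a * ∑ j, ∑ k, q (j, k))) +
      θ 2 * (c * a * (b * ∑ i, ∑ k, r (k, i)))) ≤ M * (a * b * c) := by
    refine mul_le_mul_of_nonneg_left ?_ hM
    have : (a * b * c : ℝ) = (θ 0 + θ 1 + θ 2) * (a * b * c) := by
      rw [sum_stdSimplex_three hθ, one_mul]
    rw [this]
    linarith
  have g5 : D * (a * b * c) ≤ M * (a * b * c) := by
    refine le_trans (le_of_eq (by ring)) (h2.trans (le_trans (le_of_eq ?_) g4))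
    ring
  exact le_of_mul_le_mul_right g5 hpos

theorem upperSupport_matMul (hθ : θ ∈ stdSimplex ℝ (Fin 3)) {a b c : ℕ} (ha : 0 < a) (hb : 0 < b)
    (hc : 0 < c) : upperSupport θ (matMul K a b c) = geomMean θ (a * b) (b * c) (c * a) := by
  refine le_antisymm ((upperSupport_le_geomMean_card hθ _).trans_eq ?_)
    (le_of_forall_gt_imp_ge_of_dense fun M hM => ?_)
  · have e : ∀ m n : ℕ, Fintype.card (Fin m × Fin n) = m * n := by simp
    rw [show Fintype.card (matMul K a b c).I = a * b from e a b,
      show Fintype.card (matMul K a b c).J = b * c from e b c,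
      show Fintype.card (matMul K a b c).L = c * a from e c a]
    push_cast
    rfl
  · obtain ⟨Z⟩ := exists_certificate hθ hM
    exact Z.geomMean_le_of_matMul hθ ha hb hc

theorem upperSupport_eq_zero (hθ : θ ∈ stdSimplex ℝ (Fin 3)) {T : Tensor3 K}
    (h : ∀ i j l, T.coeff i j l = 0) : upperSupport θ T = 0 :=
  le_antisymm ((Certificate.mk le_rfl (Pi.basisFun K T.I) (Pi.basisFun K T.J) (Pi.basisFun K T.L)
    0 0 0 (fun _ => le_rfl) (fun _ => le_rfl) (fun _ => le_rfl) (by simp) (by simp) (by simp)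
    (by simp [trilin, h])).upperSupport_le hθ) (upperSupport_nonneg T)

theorem upperSupport_kron_matMul (hθ : θ ∈ stdSimplex ℝ (Fin 3)) (a b c a' b' c' : ℕ) :
    upperSupport θ (kron (matMul K a b c) (matMul K a' b' c')) =
      upperSupport θ (matMul K a b c) * upperSupport θ (matMul K a' b' c') := by
  rw [le_antisymm (upperSupport_mono hθ (restricts_kron_matMul ..))
    (upperSupport_mono hθ (matMul_restricts_kron a b c a' b' c'))]
  have hzero : ∀ {a b c : ℕ}, ¬ (0 < a ∧ 0 < b ∧ 0 < c) → upperSupport θ (matMul K a b c) = 0 := by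
    refine fun {a b c} h => upperSupport_eq_zero hθ ?_
    rintro ⟨i, j⟩ ⟨-, k⟩ -
    exact absurd ⟨i.pos, j.pos, k.pos⟩ h
  by_cases h : 0 < a ∧ 0 < b ∧ 0 < c
  · by_cases h' : 0 < a' ∧ 0 < b' ∧ 0 < c'
    · obtain ⟨ha, hb, hc⟩ := h
      obtain ⟨ha', hb', hc'⟩ := h'
      rw [upperSupport_matMul hθ ha hb hc, upperSupport_matMul hθ ha' hb' hc',
        upperSupport_matMul hθ (Nat.mul_pos ha ha') (Nat.mul_pos hb hb') (Nat.mul_pos hc hc'),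
        ← geomMean_mul (by positivity) (by positivity) (by positivity) (by positivity)
          (by positivity) (by positivity)]
      push_cast
      congr 1 <;> ring
    · rw [hzero h', mul_zero, hzero]
      simp only [Nat.mul_pos_iff_of_pos_left h.1, Nat.mul_pos_iff_of_pos_left h.2.1,
        Nat.mul_pos_iff_of_pos_left h.2.2]
      exact h'
  · rw [hzero h, zero_mul, hzero]
    exact fun hh => h ⟨Nat.pos_of_mul_pos_right hh.1, Nat.pos_of_mul_pos_right hh.2.1,
      Nat.pos_of_mul_pos_right hh.2.2⟩

/-! ### Diagonal tensors -/

theorem dsum_unit_restricts (n : ℕ) : Restricts ((unit K n).dsum (unit K 1)) (unit K (n + 1)) := by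
  let e : Fin n ⊕ Fin 1 ≃ Fin (n + 1) := finSumFinEquiv
  refine restricts_of_maps e e e fun (x : Fin n ⊕ Fin 1) (y : Fin n ⊕ Fin 1)
    (z : Fin n ⊕ Fin 1) => ?_
  have h : ∀ x y : Fin n ⊕ Fin 1, e x = e y ↔ x = y := fun x y => e.apply_eq_iff_eq
  rcases x with x | x <;> rcases y with y | y <;> rcases z with z | z <;> simp [unit, dsum, h]

theorem upperSupport_unit (hθ : θ ∈ stdSimplex ℝ (Fin 3)) (n : ℕ) :
    upperSupport θ (unit K n) = n := by
  refine le_antisymm ((upperSupport_le_geomMean_card hθ _).trans_eq ?_) ?_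
  · have e : Fintype.card (Fin n) = n := Fintype.card_fin n
    rw [show Fintype.card (unit K n).I = n from e, show Fintype.card (unit K n).J = n from e,
      show Fintype.card (unit K n).L = n from e]
    exact geomMean_self hθ n.cast_nonneg
  · induction n with
    | zero => simpa using upperSupport_nonneg _
    | succ n ih =>
      have h1 : (1 : ℝ) ≤ upperSupport θ (unit K 1) := by
        refine le_trans (le_of_eq ?_) (upperSupport_mono hθ matMul_one_restricts_unit)
        rw [upperSupport_matMul hθ one_pos one_pos one_pos]
        simp [geomMean]
      have h2 := upperSupport_mono hθ (dsum_unit_restricts (K := K) n)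
      rw [upperSupport_dsum hθ] at h2
      push_cast
      linarith

/-! ### Flattening ranks and the asymptotic rank -/

theorem card_le_rank {T : Tensor3 K} {α : Type} [Fintype α] {g : α → T.I}
    (h : LinearIndependent K fun (a : α) (x : T.J × T.L) => T.coeff (g a) x.1 x.2) :
    Fintype.card α ≤ T.rank := by
  obtain ⟨a, b, c, H⟩ := restricts_iff.1 T.restricts_rank
  let v : Fin T.rank → T.J × T.L → K := fun u x => b u x.1 * c u x.2
  have hv : ∀ i, (fun x : T.J × T.L => T.coeff i x.1 x.2) ∈ Submodule.span K (Set.range v) := by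
    intro i
    refine (Submodule.mem_span_range_iff_exists_fun K).2 ⟨fun u => a u i, funext fun x => ?_⟩
    rw [H]
    have e : ∀ (f : Fin T.rank → Fin T.rank → Fin T.rank → K),
        ∑ u, ∑ v, ∑ w, (if u = v ∧ v = w then 1 else 0) * f u v w = ∑ u, f u u u := by
      intro f
      refine Finset.sum_congr rfl fun u _ => ?_
      rw [Finset.sum_eq_single u, Finset.sum_eq_single u] <;> simp +contextual [eq_comm]
    have := e fun u v w => a u i * b v x.1 * c w x.2
    simp only [← mul_assoc] at this
    refine Eq.trans ?_ this.symm
    simp [v, mul_assoc]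
  have h2 : LinearIndependent K fun a : α =>
      (⟨_, hv (g a)⟩ : Submodule.span K (Set.range v)) :=
    LinearIndependent.of_comp (Submodule.subtype _) h
  exact h2.fintype_card_le_finrank.trans ((finrank_range_le_card v).trans_eq (Fintype.card_fin _))

/-- Rows of a flattening that are linearly independent give independent rows in all Kronecker
powers. -/
theorem card_pow_le_rank_kronPow {T : Tensor3 K} {α : Type} [Fintype α] {g : α → T.I}
    (h : LinearIndependent K fun (a : α) (x : T.J × T.L) => T.coeff (g a) x.1 x.2) (k : ℕ) :
    Fintype.card α ^ k ≤ (T.kronPow k).rank := by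
  obtain ⟨β, _, f, hβ, hf⟩ : ∃ (β : Type) (_ : Fintype β) (f : β → (T.kronPow k).I),
      Fintype.card β = Fintype.card α ^ k ∧ LinearIndependent K
        fun (b : β) (x : (T.kronPow k).J × (T.kronPow k).L) =>
          (T.kronPow k).coeff (f b) x.1 x.2 := by
    induction k with
    | zero =>
      refine ⟨Unit, inferInstance, fun _ => (0 : Fin 1), by simp,
        linearIndependent_unique_iff.2 fun h0 => ?_⟩
      have := congrFun h0 ((0 : Fin 1), (0 : Fin 1))
      simp [kronPow, unit] at this
    | succ k ih =>
      obtain ⟨β, _, f, hβ, hf⟩ := ih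
      exact ⟨β × α, inferInstance, fun x => (f x.1, g x.2), by
        rw [Fintype.card_prod, hβ, pow_succ],
        linearIndependent_mul hf h (fun x y => ((x.1, y.1), (x.2, y.2))) fun _ _ _ _ => rfl⟩
  exact hβ ▸ card_le_rank hf

/-- A maximal linearly independent subfamily, with the coefficients of the other vectors. -/
theorem exists_independent_rows {X Y : Type} [Fintype X] (v : X → Y → K) :
    ∃ (α : Type) (_ : Fintype α) (g : α → X) (c : α → X → K),
      LinearIndependent K (fun a => v (g a)) ∧ ∀ x y, v x y = ∑ a, c a x * v (g a) y := by
  classical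
  obtain ⟨α, g, hg, hspan, hli⟩ := exists_linearIndependent' K v
  have : Fintype α := Fintype.ofInjective g hg
  have h : ∀ x, ∃ c : α → K, ∑ a, c a • v (g a) = v x := fun x =>
    (Submodule.mem_span_range_iff_exists_fun K).1
      (hspan.ge (Submodule.subset_span ⟨x, rfl⟩))
  choose c hc using h
  refine ⟨α, this, g, fun a x => c x a, hli, fun x y => ?_⟩
  simpa using (congrFun (hc x) y).symm

/-- The cyclic rotation of the three factors. -/
def rotate (T : Tensor3 K) : Tensor3 K where
  I := T.J
  J := T.L
  L := T.I
  coeff j l i := T.coeff i j l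

theorem rank_rotate_le (T : Tensor3 K) : T.rotate.rank ≤ T.rank := by
  refine Nat.sInf_le ?_
  obtain ⟨a, b, c, h⟩ := restricts_iff.1 T.restricts_rank
  have hr : Restricts T.rotate (unit K T.rank).rotate := by
    refine restricts_iff.2 ⟨b, c, a, fun j l i => ?_⟩
    refine (h i j l).trans ?_
    rw [Finset.sum_comm]
    refine Finset.sum_congr rfl fun j' _ => ?_
    rw [Finset.sum_comm]
    exact Finset.sum_congr rfl fun l' _ => Finset.sum_congr rfl fun i' _ => by
      simp only [rotate]; ring
  refine hr.trans (restricts_of_maps id id id fun j l i => ?_)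
  simp only [rotate, unit, id]
  congr 1
  grind

theorem kronPow_rotate_restricts (T : Tensor3 K) (k : ℕ) :
    Restricts (T.rotate.kronPow k) (T.kronPow k).rotate := by
  induction k with
  | zero =>
    refine restricts_of_maps id id id fun j l i => ?_
    simp only [rotate, kronPow, unit, id]
    congr 1
    grind
  | succ k ih => exact (ih.kron (Restricts.refl T.rotate)).trans (Restricts.refl _)

theorem rank_kronPow_rotate_le (T : Tensor3 K) (k : ℕ) :
    (T.rotate.kronPow k).rank ≤ (T.kronPow k).rank :=
  (T.kronPow_rotate_restricts k).rank_le.trans (rank_rotate_le _)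

theorem le_asymptoticRank_of_pow_le {T : Tensor3 K} {m : ℕ}
    (h : ∀ k, m ^ k ≤ (T.kronPow k).rank) : (m : ℝ) ≤ T.asymptoticRank := by
  refine ge_of_tendsto (tendsto_asymptoticRank T) ?_
  filter_upwards [eventually_ne_atTop 0] with k hk
  rw [one_div]
  calc (m : ℝ) = ((m : ℝ) ^ k) ^ ((k : ℝ)⁻¹) := (Real.pow_rpow_inv_natCast m.cast_nonneg hk).symm
    _ ≤ _ := Real.rpow_le_rpow (by positivity) (by exact_mod_cast h k) (by positivity)

/-- `T` is equivalent to a tensor whose side lengths are its three flattening ranks. These bound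
`ζ^θ(T)` from above, and their powers bound the ranks of the Kronecker powers from below. -/
theorem upperSupport_le_asymptoticRank (hθ : θ ∈ stdSimplex ℝ (Fin 3)) (T : Tensor3 K) :
    upperSupport θ T ≤ T.asymptoticRank := by
  obtain ⟨α, _, f, a, hf, ha⟩ :=
    exists_independent_rows fun (i : T.I) (x : T.J × T.L) => T.coeff i x.1 x.2
  obtain ⟨β, _, g, b, hg, hb⟩ :=
    exists_independent_rows fun (j : T.J) (x : T.L × T.I) => T.coeff x.2 j x.1
  obtain ⟨γ, _, h, c, hh, hc⟩ :=
    exists_independent_rows fun (l : T.L) (x : T.I × T.J) => T.coeff x.1 x.2 l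
  let T' : Tensor3 K := ⟨α, β, γ, fun i j l => T.coeff (f i) (g j) (h l)⟩
  have hT : Restricts T T' := by
    refine restricts_iff.2 ⟨a, b, c, fun i j l => ?_⟩
    rw [ha i (j, l)]
    refine Finset.sum_congr rfl fun i' _ => ?_
    rw [hb j (l, f i'), Finset.mul_sum]
    refine Finset.sum_congr rfl fun j' _ => ?_
    rw [hc l (f i', g j'), Finset.mul_sum, Finset.mul_sum]
    exact Finset.sum_congr rfl fun l' _ => by simp only [T']; ring
  have h1 : (Fintype.card α : ℝ) ≤ T.asymptoticRank :=
    le_asymptoticRank_of_pow_le fun k => card_pow_le_rank_kronPow hf k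
  have h2 : (Fintype.card β : ℝ) ≤ T.asymptoticRank :=
    le_asymptoticRank_of_pow_le fun k =>
      (card_pow_le_rank_kronPow (T := T.rotate) hg k).trans (T.rank_kronPow_rotate_le k)
  have h3 : (Fintype.card γ : ℝ) ≤ T.asymptoticRank :=
    le_asymptoticRank_of_pow_le fun k =>
      (card_pow_le_rank_kronPow (T := T.rotate.rotate) hh k).trans
        ((T.rotate.rank_kronPow_rotate_le k).trans (T.rank_kronPow_rotate_le k))
  calc upperSupport θ T ≤ upperSupport θ T' := upperSupport_mono hθ hT
    _ ≤ geomMean θ (Fintype.card α) (Fintype.card β) (Fintype.card γ) :=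
      upperSupport_le_geomMean_card hθ T'
    _ ≤ geomMean θ T.asymptoticRank T.asymptoticRank T.asymptoticRank :=
      geomMean_mono hθ (by positivity) (by positivity) (by positivity) h1 h2 h3
    _ = T.asymptoticRank := geomMean_self hθ ((Nat.cast_nonneg _).trans h1)

theorem isBarrierFunctional_upperSupport (hθ : θ ∈ stdSimplex ℝ (Fin 3)) :
    IsBarrierFunctional (upperSupport θ : Tensor3 K → ℝ) where
  nonneg := upperSupport_nonneg
  mono _ _ := upperSupport_mono hθ
  submul := upperSupport_kron_le hθ
  matMul_mul := upperSupport_kron_matMul hθ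
  add := upperSupport_dsum hθ
  le_asymptoticRank := upperSupport_le_asymptoticRank hθ
  normalized := upperSupport_unit hθ

end

end Tensor3

/-- Barrier for `T`-methods, for every upper support functional and every other map with the
properties listed in `IsBarrierFunctional`. -/
theorem mainTheorem2 {K : Type*} [Field K] (F : Tensor3 K → ℝ)
    (hF : (∃ θ ∈ stdSimplex ℝ (Fin 3), F = Tensor3.upperSupport θ) ∨
      Tensor3.IsBarrierFunctional F)
    (p : ℝ) (hp : 0 ≤ p) (T : Tensor3 K) (M : Tensor3.TMethod T p) :
    1 < F T ∧ BddBelow (M.bound '' M.reductions) ∧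
    Real.logb 2 (Tensor3.quasi F p) * Real.logb 2 T.asymptoticRank / Real.logb 2 (F T)
      ≤ M.omegaHat ∧
    ∀ κ : ℝ, M.IsCatalytic κ →
      Real.logb 2 (Tensor3.quasi F p) * Real.logb 2 T.asymptoticRank / Real.logb 2 (F T)
        + κ * (Real.logb 2 T.asymptoticRank / Real.logb 2 (F T) - 1) ≤ M.omegaHat := by
  have hF' : Tensor3.IsBarrierFunctional F := by
    rcases hF with ⟨θ, hθ, rfl⟩ | hF
    · exact Tensor3.isBarrierFunctional_upperSupport hθ
    · exact hF
  obtain ⟨hbdd, hle⟩ := hF'.bddBelow_bound_and_le_omegaHat hp M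
  exact ⟨hF'.one_lt hp M, hbdd, hle, fun κ => hF'.le_omegaHat_of_isCatalytic hp M⟩
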